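/- For $u\in L^2(\mathbb R^3;\mathbb C)$ let $\hat u$ be the Fourier transform with the normalization $\hat u(\xi)=\int_{\mathbb R^3}e^{-2\pi i x\cdot\xi}u(x)\,dx$, and put $$\|u\|_{H^{1/2}}^2=\int_{\mathbb R^3}(1+|\xi|^2)^{1/2}|\hat u(\xi)|^2\,d\xi,\qquad \|u\|_{\dot H^{1/2}}^2=\int_{\mathbb R^3}|\xi|\,|\hat u(\xi)|^2\,d\xi,\qquad D(u)=\iint_{\mathbb R^3\times\mathbb R^3}\frac{|u(x)|^2|u(y)|^2}{|x-y|}\,dx\,dy .$$ Let $H^{1/2}(\mathbb R^3)=\{u\in L^2(\mathbb R^3;\mathbb C):\|u\|_{H^{1/2}}<\infty\}$. For $\alpha,\beta,\rho>0$ define $$I_{8/3}^{\alpha,\beta}(\rho)=\inf\Big\{\tfrac12\|u\|_{H^{1/2}}^2+\alpha D(u)-\beta\int_{\mathbb R^3}|u|^{8/3}\,dx \;:\; u\in H^{1/2}(\mathbb R^3),\ \int_{\mathbb R^3}|u|^2\,dx=\rho\Big\}\in[-\infty,\infty).$$ Let $S$ be the infimum of all $C\in(0,\infty]$ such that $$\|\varphi\|_{L^{8/3}(\mathbb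 R^3)}\le C\,\|\varphi\|_{\dot H^{1/2}}^{1/2}\,D(\varphi)^{1/8}\qquad\text{for all }\varphi\in C_0^\infty(\mathbb R^3;\mathbb C).$$ **Theorem.** Let $\alpha,\beta>0$ be fixed. Then the following are equivalent: 1. there exists $\rho>0$ such that $I_{8/3}^{\alpha,\beta}(\rho)=-\infty$; 2. $\left(\dfrac{27\alpha}{\beta^3}\right)^{1/8}<\sqrt2\,S$. -/

import Mathlib

open MeasureTheory FourierTransform
open scoped ENNReal ContDiff

noncomputable section

namespace SemiRelativistic

/-- Euclidean three-space `ℝ³`. -/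
abbrev R3 : Type := EuclideanSpace ℝ (Fin 3)

/-- The complex space `L²(ℝ³)`. -/
abbrev L2 : Type := Lp ℂ 2 (volume : Measure R3)

/-- The Coulomb energy `∬ |f(x)|² |f(y)|² / |x - y| dx dy`. -/
def coulomb (f : R3 → ℂ) : ℝ≥0∞ :=
  ∫⁻ x, ∫⁻ y, ‖f x‖ₑ ^ 2 * ‖f y‖ₑ ^ 2 / ‖x - y‖ₑ

/-- The squared norm `‖u‖²_{H^s} = ∫ (1 + |ξ|²)^s |û(ξ)|² dξ` of `u ∈ L²(ℝ³)`, possibly `∞`, where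
`û` is the Fourier transform on `L²`, with kernel `e^{-2πi x·ξ}`. -/
def sobolevNormSq (s : ℝ) (u : L2) : ℝ≥0∞ :=
  ∫⁻ ξ, ENNReal.ofReal ((1 + ‖ξ‖ ^ 2) ^ s) * ‖(𝓕 u : L2) ξ‖ₑ ^ 2

/-- The homogeneous norm `‖φ‖_{Ḣ^s} = (∫ |ξ|^{2s} |φ̂(ξ)|² dξ)^{1/2}` of an integrable function,
where `φ̂(ξ) = ∫ e^{-2πi x·ξ} φ(x) dx`. -/
def homSobolevNorm (s : ℝ) (φ : R3 → ℂ) : ℝ≥0∞ :=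
  (∫⁻ ξ, ENNReal.ofReal (‖ξ‖ ^ (2 * s)) * ‖𝓕 φ ξ‖ₑ ^ 2) ^ (1 / 2 : ℝ)

/-- The sphere `S(ρ) = {u ∈ H^{1/2}(ℝ³) : ∫ |u|² = ρ}`. -/
def sphere (ρ : ℝ) : Set L2 :=
  {u | sobolevNormSq (1 / 2) u < ⊤ ∧ ∫ x, ‖u x‖ ^ 2 = ρ}

/-- The energy `½ ‖u‖²_{H^{1/2}} + α ∬ |u(x)|²|u(y)|²/|x-y| dx dy - β ∫ |u|^p`.
For `u ∈ H^{1/2}(ℝ³)` and `2 ≤ p ≤ 3` the three terms are finite, so this is a real number. -/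
def energy (p α β : ℝ) (u : L2) : EReal :=
  ((1 / 2 : ℝ) : EReal) * (sobolevNormSq (1 / 2) u : EReal)
    + (α : EReal) * (coulomb u : EReal)
    - (β : EReal) * ((∫⁻ x, ‖u x‖ₑ ^ p : ℝ≥0∞) : EReal)

/-- The infimum `I_p^{α,β}(ρ)` of the energy over `S(ρ)`, an extended real number. -/
def minEnergy (p α β ρ : ℝ) : EReal :=
  ⨅ u ∈ sphere ρ, energy p α β u

/-- `‖φ‖_{8/3} ≤ C ‖φ‖_{Ḣ^{1/2}}^{1/2} (∬ |φ(x)|²|φ(y)|²/|x-y| dx dy)^{1/8}` for every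
`φ ∈ C_0^∞(ℝ³)`. -/
def InterpolationInequality (C : ℝ≥0∞) : Prop :=
  ∀ φ : R3 → ℂ, ContDiff ℝ (∞ : WithTop ℕ∞) φ → HasCompactSupport φ →
    eLpNorm φ (8 / 3) volume
      ≤ C * homSobolevNorm (1 / 2) φ ^ (1 / 2 : ℝ) * coulomb φ ^ (1 / 8 : ℝ)

/-- The best constant `S = inf {C ∈ (0, ∞] : C satisfies the interpolation inequality}`. -/
def bestConstant : ℝ≥0∞ :=
  sInf {C : ℝ≥0∞ | 0 < C ∧ InterpolationInequality C}

end SemiRelativistic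

end

noncomputable section

namespace SemiRelativistic

open scoped SchwartzMap
open Filter Topology LineDeriv

/-! Write T for `kinetic`, D for `coulomb` and P for `powerIntegral`. The eighth power of the
interpolation inequality is P³ ≤ C⁸T²D, and the critical constant C₀ = (27α/β³)^{1/8}/√2 has C₀⁸ =
27α/(16β³). Both directions rest on the arithmetic-geometric mean inequality T/4 + T/4 + αD ≥
3(αT²D/16)^{1/3}: at C₀ the interpolation inequality gives βP ≤ T/2 + αD, and equality in the mean
inequality can always be reached by changing the amplitude.

If C₀ < S, some test function f violates the inequality at C₀. Put u(x) = (sl)^{3/2} f(lx). Its mass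
s³∫|f|² does not depend on l, while its energy is at most a constant plus l·s³(T/2 + αs³D - βsP).
The choice s³ = T/(4αD) is the equality case αs³D = T/4 and makes the bracket negative, so the
energy tends to -∞ as l → ∞ (`exists_neg_of_cube_lt`, `exists_minEnergy_eq_bot`).

If S ≤ C₀, then βP ≤ T/2 + αD on test functions (`coulomb_interpolation_of_le`). Since T is at most
the squared H^{1/2} norm, a density argument makes the energy nonnegative on all of H^{1/2}, for
every mass (`energy_inequality_of_compactSupport`, `energy_nonneg`). The limit needs three facts:
density of test functions in H^{1/2}; the embedding of H^{1/2} in L^{8/3}, proved by layer cake with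
a frequency cutoff depending on the height; and upper semicontinuity of D along the approximation,
from Minkowski's inequality and a Coulomb bound by L² and L^{8/3} norms. P passes to the limit by
Fatou. -/

/-- The integral `∫ |f|^{8/3}`. -/
def powerIntegral (f : R3 → ℂ) : ℝ≥0∞ := ∫⁻ x, ‖f x‖ₑ ^ (8 / 3 : ℝ)

/-- The massless kinetic energy `∫ |ξ| |f̂(ξ)|² dξ`. -/
def kinetic (f : R3 → ℂ) : ℝ≥0∞ := ∫⁻ ξ, ENNReal.ofReal ‖ξ‖ * ‖𝓕 f ξ‖ₑ ^ 2

/-! ### The interpolation inequality at the critical constant -/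

lemma eLpNorm_pow_eight (f : R3 → ℂ) :
    eLpNorm f (8 / 3) volume ^ 8 = powerIntegral f ^ 3 := by
  have h : ((8 : ℝ≥0∞) / 3).toReal = 8 / 3 := by simp
  rw [eLpNorm_eq_lintegral_rpow_enorm_toReal (by simp) (by simp [ENNReal.div_eq_top]), h,
    ← ENNReal.rpow_natCast, ← ENNReal.rpow_mul, ← ENNReal.rpow_natCast, powerIntegral]
  norm_num

lemma homSobolevNorm_rpow_pow_eight (f : R3 → ℂ) :
    (homSobolevNorm (1 / 2) f ^ (1 / 2 : ℝ)) ^ 8 = kinetic f ^ 2 := by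
  have h : (2 * (1 / 2) : ℝ) = 1 := by norm_num
  rw [homSobolevNorm, ← ENNReal.rpow_natCast, ← ENNReal.rpow_mul, ← ENNReal.rpow_mul,
    ← ENNReal.rpow_natCast, kinetic]
  simp only [h, Real.rpow_one]
  norm_num

/-- The eighth power clears every fractional exponent and leaves the cubic form that matches the
mean inequality. -/
lemma interpolation_iff_pow (C : ℝ≥0∞) (f : R3 → ℂ) :
    eLpNorm f (8 / 3) volume
        ≤ C * homSobolevNorm (1 / 2) f ^ (1 / 2 : ℝ) * coulomb f ^ (1 / 8 : ℝ) ↔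
      powerIntegral f ^ 3 ≤ C ^ 8 * kinetic f ^ 2 * coulomb f := by
  have h : (coulomb f ^ (1 / 8 : ℝ)) ^ 8 = coulomb f := by
    rw [← ENNReal.rpow_natCast, ← ENNReal.rpow_mul]; norm_num
  rw [← ENNReal.pow_le_pow_left_iff (n := 8) (by norm_num), mul_pow, mul_pow, eLpNorm_pow_eight,
    homSobolevNorm_rpow_pow_eight, h]

/-- Arithmetic-geometric mean inequality for `T/4`, `T/4` and `αD`. -/
lemma mul_le_half_add_of_cube_le {α β T D P : ℝ} (hα : 0 < α) (hT : 0 ≤ T)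
    (hD : 0 ≤ D) (h : 16 * β ^ 3 * P ^ 3 ≤ 27 * α * T ^ 2 * D) :
    β * P ≤ 1 / 2 * T + α * D := by
  have hb : 0 ≤ α * D := by positivity
  have key : 27 * (T / 4) ^ 2 * (α * D) ≤ (1 / 2 * T + α * D) ^ 3 := by
    generalize α * D = b at hb
    obtain ⟨a, rfl⟩ : ∃ a, T = 4 * a := ⟨T / 4, by ring⟩
    have ha : 0 ≤ a := by linarith
    -- The difference of the two sides is exactly (8a + b)(a - b)².
    nlinarith [mul_nonneg (by positivity : 0 ≤ 8 * a + b) (sq_nonneg (a - b))]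
  have : (β * P) ^ 3 ≤ (1 / 2 * T + α * D) ^ 3 := by nlinarith
  exact le_of_pow_le_pow_left₀ (by norm_num) (by positivity) this

/-- The critical value of the constant in the interpolation inequality. -/
lemma critical_pow_eight {α β : ℝ} (hα : 0 < α) (hβ : 0 < β) :
    (ENNReal.ofReal ((27 * α / β ^ 3) ^ (1 / 8 : ℝ)) / ENNReal.ofReal (Real.sqrt 2)) ^ 8
      = ENNReal.ofReal (27 * α / (16 * β ^ 3)) := by
  rw [← ENNReal.ofReal_div_of_pos (by positivity), ← ENNReal.ofReal_pow (by positivity), div_pow,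
    ← Real.rpow_natCast ((27 * α / β ^ 3) ^ (1 / 8 : ℝ)), ← Real.rpow_mul (by positivity),
    show (Real.sqrt 2) ^ 8 = ((Real.sqrt 2) ^ 2) ^ 4 by ring, Real.sq_sqrt (by norm_num)]
  congr 1
  norm_num
  field_simp

/-- At the critical constant the mean inequality turns the product bound into a sum bound with
exactly the coefficients of the energy. -/
lemma coulomb_interpolation_of_le {α β : ℝ} (hα : 0 < α) (hβ : 0 < β)
    (h : ENNReal.ofReal (Real.sqrt 2) * bestConstant
      ≤ ENNReal.ofReal ((27 * α / β ^ 3) ^ (1 / 8 : ℝ)))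
    {φ : R3 → ℂ} (hφ : ContDiff ℝ (∞ : WithTop ℕ∞) φ) (hc : HasCompactSupport φ) :
    ENNReal.ofReal β * powerIntegral φ
      ≤ ENNReal.ofReal (1 / 2) * kinetic φ + ENNReal.ofReal α * coulomb φ := by
  have h2 : 0 < Real.sqrt 2 := by positivity
  set C₀ := ENNReal.ofReal ((27 * α / β ^ 3) ^ (1 / 8 : ℝ)) / ENNReal.ofReal (Real.sqrt 2) with hC₀
  have hle : bestConstant ≤ C₀ := by
    rw [ENNReal.le_div_iff_mul_le (by simp) (by simp), mul_comm]; exact h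
  by_cases hT : kinetic φ = ⊤
  · simp [hT]
  by_cases hD : coulomb φ = ⊤
  · simp [hD, hα]
  -- An infimum only makes constants above C₀ admissible; C₀ itself is reached by letting C'
  -- decrease to it, which is continuous because T and D are finite here.
  have hev : ∀ C', C₀ < C' → powerIntegral φ ^ 3 ≤ C' ^ 8 * kinetic φ ^ 2 * coulomb φ := by
    intro C' hC'
    obtain ⟨C, ⟨-, hC⟩, hCC⟩ := sInf_lt_iff.1 (hle.trans_lt hC')
    rw [← interpolation_iff_pow]
    refine (hC φ hφ hc).trans ?_
    gcongr
  have hC₀top : C₀ ≠ ⊤ := by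
    rw [hC₀]; exact ENNReal.div_ne_top (by simp) (by simp)
  have hlim : powerIntegral φ ^ 3 ≤ C₀ ^ 8 * kinetic φ ^ 2 * coulomb φ := by
    have hcont : Continuous fun C : ℝ≥0∞ => C ^ 8 * kinetic φ ^ 2 * coulomb φ := by
      refine (ENNReal.continuous_mul_const hD).comp
        ((ENNReal.continuous_mul_const (by simp [hT])).comp (ENNReal.continuous_pow 8))
    have hne : (nhdsWithin C₀ (Set.Ioi C₀)).NeBot := nhdsGT_neBot_of_exists_gt ⟨⊤, hC₀top.lt_top⟩
    refine ge_of_tendsto (hcont.continuousWithinAt (s := Set.Ioi C₀) (x := C₀)) ?_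
    filter_upwards [self_mem_nhdsWithin] with C' hC' using hev C' hC'
  rw [critical_pow_eight hα hβ] at hlim
  have hP : powerIntegral φ ≠ ⊤ := by
    rintro hP
    simp [hP, ENNReal.mul_eq_top, hT, hD] at hlim
  lift powerIntegral φ to NNReal using hP with P
  lift kinetic φ to NNReal using hT with T
  lift coulomb φ to NNReal using hD with D
  have hr : 16 * β ^ 3 * (P : ℝ) ^ 3 ≤ 27 * α * (T : ℝ) ^ 2 * D := by
    have := ENNReal.toReal_mono (by finiteness) hlim
    simp only [ENNReal.toReal_pow, ENNReal.toReal_mul, ENNReal.coe_toReal] at this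
    rw [ENNReal.toReal_ofReal (by positivity)] at this
    have e : 27 * α * (T : ℝ) ^ 2 * D
        = 16 * β ^ 3 * (27 * α / (16 * β ^ 3) * (T : ℝ) ^ 2 * D) := by field_simp
    rw [e]; gcongr
  have := mul_le_half_add_of_cube_le hα T.2 D.2 hr
  rw [← ENNReal.ofReal_coe_nnreal, ← ENNReal.ofReal_coe_nnreal, ← ENNReal.ofReal_coe_nnreal,
    ← ENNReal.ofReal_mul hβ.le, ← ENNReal.ofReal_mul (by norm_num), ← ENNReal.ofReal_mul hα.le,
    ← ENNReal.ofReal_add (by positivity) (by positivity)]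
  exact ENNReal.ofReal_le_ofReal this

lemma exists_lt_of_lt_bestConstant {α β : ℝ} (hα : 0 < α) (hβ : 0 < β)
    (h : ENNReal.ofReal ((27 * α / β ^ 3) ^ (1 / 8 : ℝ))
      < ENNReal.ofReal (Real.sqrt 2) * bestConstant) :
    ∃ φ : R3 → ℂ, ContDiff ℝ (∞ : WithTop ℕ∞) φ ∧ HasCompactSupport φ ∧
      ENNReal.ofReal (27 * α / (16 * β ^ 3)) * kinetic φ ^ 2 * coulomb φ
        < powerIntegral φ ^ 3 := by
  have h2 : 0 < Real.sqrt 2 := by positivity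
  set C₀ := ENNReal.ofReal ((27 * α / β ^ 3) ^ (1 / 8 : ℝ)) / ENNReal.ofReal (Real.sqrt 2) with hC₀
  have hlt : C₀ < bestConstant := by
    rw [hC₀]; apply ENNReal.div_lt_of_lt_mul' h
  have hpos : 0 < C₀ := by
    rw [hC₀, ← ENNReal.ofReal_div_of_pos h2, ENNReal.ofReal_pos]
    positivity
  have hn : ¬ InterpolationInequality C₀ := fun hI => (notMem_of_lt_csInf' hlt) ⟨hpos, hI⟩
  simp only [InterpolationInequality, not_forall, interpolation_iff_pow,
    critical_pow_eight hα hβ, not_le, C₀] at hn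
  obtain ⟨φ, h1, h2, h3⟩ := hn
  exact ⟨φ, h1, h2, h3⟩

/-! ### Invariance almost everywhere and nondegeneracy of the functionals -/

lemma coulomb_congr_ae {f g : R3 → ℂ} (h : f =ᵐ[volume] g) : coulomb f = coulomb g := by
  refine lintegral_congr_ae ?_
  filter_upwards [h] with x hx
  refine lintegral_congr_ae ?_
  filter_upwards [h] with y hy
  rw [hx, hy]

lemma powerIntegral_congr_ae {f g : R3 → ℂ} (h : f =ᵐ[volume] g) :
    powerIntegral f = powerIntegral g := by
  refine lintegral_congr_ae ?_
  filter_upwards [h] with x hx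
  rw [hx]

lemma sobolevNormSq_toLp (s : ℝ) (f : 𝓢(R3, ℂ)) :
    sobolevNormSq s (f.toLp 2)
      = ∫⁻ ξ, ENNReal.ofReal ((1 + ‖ξ‖ ^ 2) ^ s) * ‖𝓕 (f : R3 → ℂ) ξ‖ₑ ^ 2 := by
  rw [sobolevNormSq, SchwartzMap.toLp_fourier_eq]
  refine lintegral_congr_ae ?_
  filter_upwards [(𝓕 f).coeFn_toLp 2 volume] with ξ hξ
  rw [hξ, SchwartzMap.fourier_coe]

/-- The weight |ξ| vanishes only on the null set {0}, so the transform vanishes almost everywhere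
and Plancherel applies. -/
lemma ae_eq_zero_of_kinetic_eq_zero (f : 𝓢(R3, ℂ)) (h : kinetic f = 0) : ⇑f =ᵐ[volume] 0 := by
  rw [kinetic, ← SchwartzMap.fourier_coe, lintegral_eq_zero_iff
    (by have := (𝓕 f).continuous.measurable; fun_prop)] at h
  have h0 : (𝓕 f).toLp 2 (volume : Measure R3) = 0 := by
    rw [Lp.eq_zero_iff_ae_eq_zero]
    filter_upwards [h, (𝓕 f).coeFn_toLp 2 volume, Measure.ae_ne volume (0 : R3)] with ξ h1 h2 h3
    rw [h2]
    simpa [h3] using h1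
  rw [← SchwartzMap.toLp_fourier_eq] at h0
  have h1 : f.toLp 2 (volume : Measure R3) = 0 := by
    rw [← norm_eq_zero, ← Lp.norm_fourier_eq, h0, norm_zero]
  rw [Lp.eq_zero_iff_ae_eq_zero] at h1
  exact (f.coeFn_toLp 2 volume).symm.trans h1

lemma ae_eq_zero_of_coulomb_eq_zero {f : R3 → ℂ} (hf : Measurable f) (h : coulomb f = 0) :
    f =ᵐ[volume] 0 := by
  have hm : Measurable fun p : R3 × R3 => ‖f p.1‖ₑ ^ 2 * ‖f p.2‖ₑ ^ 2 / ‖p.1 - p.2‖ₑ := by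
    fun_prop
  rw [coulomb, lintegral_eq_zero_iff hm.lintegral_prod_right'] at h
  by_contra hne
  have hex : ∃ x, f x ≠ 0 ∧ ∫⁻ y, ‖f x‖ₑ ^ 2 * ‖f y‖ₑ ^ 2 / ‖x - y‖ₑ = 0 := by
    by_contra! hall
    apply hne
    filter_upwards [h] with x hx
    by_contra hfx
    exact hall x hfx hx
  obtain ⟨x, hx, hx0⟩ := hex
  rw [lintegral_eq_zero_iff (by fun_prop)] at hx0
  apply hne
  filter_upwards [hx0] with y hy
  simpa [hx] using hy

lemma powerIntegral_eq_zero_of_ae {f : R3 → ℂ} (h : f =ᵐ[volume] 0) : powerIntegral f = 0 := by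
  rw [powerIntegral_congr_ae h]
  simp [powerIntegral]

lemma powerIntegral_ne_top (f : 𝓢(R3, ℂ)) : powerIntegral f ≠ ⊤ := by
  have h := (f.memLp (8 / 3) volume).2
  intro hP
  have := eLpNorm_pow_eight f
  rw [hP] at this
  simp at this
  exact h.ne this

/-! ### Behaviour of the functionals under dilation -/

lemma lintegral_comp_smul (g : R3 → ℝ≥0∞) {l : ℝ} (hl : 0 < l) :
    ∫⁻ x, g (l • x) = ENNReal.ofReal ((l ^ 3)⁻¹) * ∫⁻ x, g x := by
  let e : R3 ≃ᵐ R3 := (Homeomorph.smulOfNeZero l hl.ne').toMeasurableEquiv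
  have h1 := lintegral_map_equiv (μ := (volume : Measure R3)) g e
  have h2 : Measure.map e (volume : Measure R3) = ENNReal.ofReal ((l ^ 3)⁻¹) • volume := by
    have := Measure.map_addHaar_smul (volume : Measure R3) hl.ne'
    rw [abs_of_pos (by positivity)] at this
    rw [finrank_euclideanSpace_fin] at this
    exact this
  rw [h2, lintegral_smul_measure] at h1
  exact h1.symm

/-- The rescaled function `c f(l x)`. -/
def dilate (c : ℝ) (l : ℝ) (hl : l ≠ 0) (f : 𝓢(R3, ℂ)) : 𝓢(R3, ℂ) :=
  (c : ℂ) • SchwartzMap.compCLMOfContinuousLinearEquiv ℂ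
    (ContinuousLinearEquiv.smulLeft (R₁ := ℝ) (M₁ := R3) (Units.mk0 l hl)) f

lemma dilate_apply (c l : ℝ) (hl : l ≠ 0) (f : 𝓢(R3, ℂ)) (x : R3) :
    dilate c l hl f x = c * f (l • x) := rfl

lemma fourier_dilate (c l : ℝ) (hl : 0 < l) (f : 𝓢(R3, ℂ)) (ξ : R3) :
    𝓕 (dilate c l hl.ne' f : R3 → ℂ) ξ = (c * (l ^ 3)⁻¹ : ℝ) * 𝓕 (f : R3 → ℂ) (l⁻¹ • ξ) := by
  rw [Real.fourier_eq, Real.fourier_eq]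
  have := Measure.integral_comp_smul (volume : Measure R3)
    (fun v => Real.fourierChar (-inner ℝ v (l⁻¹ • ξ)) • ((c : ℂ) * f v)) l
  have e : ∀ v : R3, inner ℝ (l • v) (l⁻¹ • ξ) = inner ℝ v ξ := by
    intro v
    rw [inner_smul_left, inner_smul_right]
    simp [hl.ne']
  simp only [e] at this
  simp only [dilate_apply]
  rw [this, abs_of_pos (by positivity)]
  have e2 : ∀ v : R3, Real.fourierChar (-inner ℝ v (l⁻¹ • ξ)) • ((c : ℂ) * f v)
      = c • (Real.fourierChar (-inner ℝ v (l⁻¹ • ξ)) • f v) := by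
    intro v
    rw [smul_comm]; simp
  simp only [e2, integral_smul]
  simp
  ring

lemma lintegral_dilate_rpow {c l : ℝ} (hc : 0 ≤ c) (hl : 0 < l) (f : 𝓢(R3, ℂ)) {p : ℝ}
    (hp : 0 ≤ p) :
    ∫⁻ x, ‖dilate c l hl.ne' f x‖ₑ ^ p
      = ENNReal.ofReal (c ^ p * (l ^ 3)⁻¹) * ∫⁻ x, ‖f x‖ₑ ^ p := by
  have e : ∀ x, ‖dilate c l hl.ne' f x‖ₑ ^ p
      = ENNReal.ofReal (c ^ p) * ‖f (l • x)‖ₑ ^ p := by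
    intro x
    rw [dilate_apply, enorm_mul, ENNReal.mul_rpow_of_nonneg _ _ hp,
      ← ENNReal.ofReal_rpow_of_nonneg hc hp]
    congr 2
    rw [← ofReal_norm, Complex.norm_real, Real.norm_of_nonneg hc]
  simp only [e]
  rw [lintegral_const_mul' _ _ (by simp), lintegral_comp_smul (fun x => ‖f x‖ₑ ^ p) hl, ← mul_assoc,
    ENNReal.ofReal_mul (by positivity)]

lemma coulomb_dilate {c l : ℝ} (hc : 0 ≤ c) (hl : 0 < l) (f : 𝓢(R3, ℂ)) :
    coulomb (dilate c l hl.ne' f) = ENNReal.ofReal (c ^ 4 * (l ^ 5)⁻¹) * coulomb f := by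
  have e : ∀ x y, ‖dilate c l hl.ne' f x‖ₑ ^ 2 * ‖dilate c l hl.ne' f y‖ₑ ^ 2 / ‖x - y‖ₑ
      = ENNReal.ofReal (c ^ 4 * l) *
        (‖f (l • x)‖ₑ ^ 2 * ‖f (l • y)‖ₑ ^ 2 / ‖l • x - l • y‖ₑ) := by
    intro x y
    have e1 : ‖(c : ℂ)‖ₑ = ENNReal.ofReal c := by
      rw [← ofReal_norm, Complex.norm_real, Real.norm_of_nonneg hc]
    have e2 : ‖l • x - l • y‖ₑ = ENNReal.ofReal l * ‖x - y‖ₑ := by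
      rw [← smul_sub, enorm_smul, Real.enorm_eq_ofReal hl.le]
    have hl0 : ENNReal.ofReal l ≠ 0 := by simpa using hl
    rw [dilate_apply, dilate_apply, enorm_mul, enorm_mul, e1, e2, ENNReal.ofReal_mul (by positivity),
      ENNReal.ofReal_pow hc, div_eq_mul_inv, div_eq_mul_inv,
      ENNReal.mul_inv (.inl hl0) (.inl (by simp))]
    calc _ = ENNReal.ofReal c ^ 4 * 1 *
          (‖f (l • x)‖ₑ ^ 2 * ‖f (l • y)‖ₑ ^ 2 * ‖x - y‖ₑ⁻¹) := by ring
      _ = ENNReal.ofReal c ^ 4 * (ENNReal.ofReal l * (ENNReal.ofReal l)⁻¹) *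
          (‖f (l • x)‖ₑ ^ 2 * ‖f (l • y)‖ₑ ^ 2 * ‖x - y‖ₑ⁻¹) := by
        rw [ENNReal.mul_inv_cancel hl0 (by simp)]
      _ = _ := by ring
  simp only [coulomb, e]
  simp_rw [lintegral_const_mul' _ _ ENNReal.ofReal_ne_top]
  have e3 : ∀ x, ∫⁻ y, ‖f (l • x)‖ₑ ^ 2 * ‖f (l • y)‖ₑ ^ 2 / ‖l • x - l • y‖ₑ
      = ENNReal.ofReal ((l ^ 3)⁻¹) * ∫⁻ y, ‖f (l • x)‖ₑ ^ 2 * ‖f y‖ₑ ^ 2 / ‖l • x - y‖ₑ :=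
    fun x => lintegral_comp_smul (fun y => ‖f (l • x)‖ₑ ^ 2 * ‖f y‖ₑ ^ 2 / ‖l • x - y‖ₑ) hl
  simp_rw [e3, lintegral_const_mul' _ _ ENNReal.ofReal_ne_top]
  rw [lintegral_comp_smul (fun x => ∫⁻ y, ‖f x‖ₑ ^ 2 * ‖f y‖ₑ ^ 2 / ‖x - y‖ₑ) hl, ← mul_assoc,
    ← mul_assoc, ← ENNReal.ofReal_mul (by positivity), ← ENNReal.ofReal_mul (by positivity)]
  congr 2
  field_simp

/-- Since √(1 + l²|η|²) ≤ 1 + l|η|, the inhomogeneous part contributes only a term that stays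
bounded in l at fixed mass. -/
lemma sobolevNormSq_dilate_le {c l : ℝ} (hc : 0 ≤ c) (hl : 0 < l) (f : 𝓢(R3, ℂ)) :
    sobolevNormSq (1 / 2) ((dilate c l hl.ne' f).toLp 2)
      ≤ ENNReal.ofReal (c ^ 2 * (l ^ 3)⁻¹) *
        ((∫⁻ ξ, ‖𝓕 (f : R3 → ℂ) ξ‖ₑ ^ 2) + ENNReal.ofReal l * kinetic f) := by
  rw [sobolevNormSq_toLp]
  have e : ∀ ξ : R3, ENNReal.ofReal ((1 + ‖ξ‖ ^ 2) ^ (1 / 2 : ℝ)) *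
        ‖𝓕 (dilate c l hl.ne' f : R3 → ℂ) ξ‖ₑ ^ 2
      = ENNReal.ofReal (c ^ 2 * (l ^ 6)⁻¹) *
        (fun η : R3 => ENNReal.ofReal ((1 + (l * ‖η‖) ^ 2) ^ (1 / 2 : ℝ)) *
          ‖𝓕 (f : R3 → ℂ) η‖ₑ ^ 2) (l⁻¹ • ξ) := by
    intro ξ
    have e1 : l * ‖l⁻¹ • ξ‖ = ‖ξ‖ := by
      rw [norm_smul, norm_inv, Real.norm_of_nonneg hl.le]; field_simp
    have e2 : ‖((c * (l ^ 3)⁻¹ : ℝ) : ℂ)‖ₑ = ENNReal.ofReal (c * (l ^ 3)⁻¹) := by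
      rw [← ofReal_norm, Complex.norm_real, Real.norm_of_nonneg (by positivity)]
    simp only [e1]
    rw [fourier_dilate c l hl, enorm_mul, e2, mul_pow, ← ENNReal.ofReal_pow (by positivity),
      show (c * (l ^ 3)⁻¹) ^ 2 = c ^ 2 * (l ^ 6)⁻¹ by ring]
    ring
  simp only [e]
  rw [lintegral_const_mul' _ _ (by simp), lintegral_comp_smul (fun η : R3 =>
      ENNReal.ofReal ((1 + (l * ‖η‖) ^ 2) ^ (1 / 2 : ℝ)) * ‖𝓕 (f : R3 → ℂ) η‖ₑ ^ 2) (inv_pos.2 hl),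
    ← mul_assoc,
    ← ENNReal.ofReal_mul (by positivity)]
  have e3 : c ^ 2 * (l ^ 6)⁻¹ * ((l⁻¹ ^ 3)⁻¹) = c ^ 2 * (l ^ 3)⁻¹ := by field_simp
  rw [e3]
  gcongr
  rw [kinetic, ← lintegral_const_mul' _ _ (by simp), ← lintegral_add_left]
  · refine lintegral_mono fun ξ => ?_
    have : (1 + (l * ‖ξ‖) ^ 2) ^ (1 / 2 : ℝ) ≤ 1 + l * ‖ξ‖ := by
      rw [← Real.sqrt_eq_rpow]
      apply Real.sqrt_le_iff.2 ⟨by positivity, ?_⟩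
      nlinarith [mul_nonneg hl.le (norm_nonneg ξ)]
    calc _ ≤ ENNReal.ofReal (1 + l * ‖ξ‖) * ‖𝓕 (f : R3 → ℂ) ξ‖ₑ ^ 2 := by gcongr
      _ = _ := by
        rw [ENNReal.ofReal_add (by norm_num) (by positivity), ENNReal.ofReal_mul hl.le]
        simp only [ENNReal.ofReal_one]
        ring
  · rw [← SchwartzMap.fourier_coe]
    have := (𝓕 f).continuous.measurable
    fun_prop

lemma integral_norm_sq_dilate {c l : ℝ} (hl : 0 < l) (f : 𝓢(R3, ℂ)) :
    ∫ x, ‖(dilate c l hl.ne' f).toLp 2 (volume : Measure R3) x‖ ^ 2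
      = c ^ 2 * (l ^ 3)⁻¹ * ∫ x, ‖f x‖ ^ 2 := by
  have h1 : ∫ x, ‖(dilate c l hl.ne' f).toLp 2 (volume : Measure R3) x‖ ^ 2
      = ∫ x, c ^ 2 * ‖f (l • x)‖ ^ 2 := by
    refine integral_congr_ae ?_
    filter_upwards [(dilate c l hl.ne' f).coeFn_toLp 2 volume] with x hx
    rw [hx, dilate_apply, norm_mul, mul_pow, Complex.norm_real, Real.norm_eq_abs, sq_abs]
  have h2 := Measure.integral_comp_smul (volume : Measure R3) (fun x => ‖f x‖ ^ 2) l
  rw [abs_of_pos (by positivity), finrank_euclideanSpace_fin] at h2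
  rw [h1, integral_const_mul, h2, smul_eq_mul, mul_assoc]

lemma lintegral_fourier_sq_ne_top (f : 𝓢(R3, ℂ)) : ∫⁻ ξ, ‖𝓕 (f : R3 → ℂ) ξ‖ₑ ^ 2 ≠ ⊤ := by
  have h := ((𝓕 f).memLp 2 volume).2
  rw [eLpNorm_lt_top_iff_lintegral_rpow_enorm_lt_top (by simp) (by simp)] at h
  rw [← SchwartzMap.fourier_coe]
  simpa using h.ne

/-! ### Energy unbounded below when the inequality fails -/

/-- The choice of amplitude which balances the kinetic and the Coulomb energy. -/
lemma exists_neg_of_cube_lt {α β T D P : ℝ} (hα : 0 < α) (hβ : 0 < β) (hT : 0 < T) (hD : 0 < D)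
    (hP : 0 < P) (h : 27 * α * T ^ 2 * D < 16 * β ^ 3 * P ^ 3) :
    ∃ s : ℝ, 0 < s ∧ 1 / 2 * T + α * s ^ 3 * D - β * s * P < 0 := by
  have hq : 0 < T / (4 * α * D) := by positivity
  -- This s gives αs³D = T/4, the equality case of the mean inequality; it remains to see 3T/4 <
  -- βsP, which is compared after cubing.
  refine ⟨(T / (4 * α * D)) ^ (1 / 3 : ℝ), by positivity, ?_⟩
  set s := (T / (4 * α * D)) ^ (1 / 3 : ℝ) with hs
  have hs0 : 0 < s := by positivity
  have hs3 : s ^ 3 = T / (4 * α * D) := by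
    rw [hs, ← Real.rpow_natCast, ← Real.rpow_mul hq.le]; norm_num
  have e : α * s ^ 3 * D = T / 4 := by rw [hs3]; field_simp
  rw [e]
  have key : (3 / 4 * T) ^ 3 < (β * s * P) ^ 3 := by
    have : (β * s * P) ^ 3 = β ^ 3 * P ^ 3 * (T / (4 * α * D)) := by rw [← hs3]; ring
    rw [this, mul_div_assoc', lt_div_iff₀ (by positivity)]
    nlinarith [mul_lt_mul_of_pos_left h hT]
  have := lt_of_pow_lt_pow_left₀ 3 (by positivity) key
  linarith

/-- Concentrating a violating function at fixed mass makes all three leading terms grow linearly in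
l, with negative total slope. -/
lemma exists_minEnergy_eq_bot {α β : ℝ} (hα : 0 < α) (hβ : 0 < β) (f : 𝓢(R3, ℂ))
    (h : ENNReal.ofReal (27 * α / (16 * β ^ 3)) * kinetic f ^ 2 * coulomb f < powerIntegral f ^ 3) :
    ∃ ρ : ℝ, 0 < ρ ∧ minEnergy (8 / 3) α β ρ = ⊥ := by
  have hCpos : ENNReal.ofReal (27 * α / (16 * β ^ 3)) ≠ 0 := by
    rw [← pos_iff_ne_zero, ENNReal.ofReal_pos]; positivity
  have hP0 : powerIntegral f ≠ 0 := by
    intro h0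
    simp [h0] at h
  have hf0 : ¬ ⇑f =ᵐ[volume] 0 := fun h0 => hP0 (powerIntegral_eq_zero_of_ae h0)
  have hT0 : kinetic f ≠ 0 := fun h0 => hf0 (ae_eq_zero_of_kinetic_eq_zero f h0)
  have hD0 : coulomb f ≠ 0 :=
    fun h0 => hf0 (ae_eq_zero_of_coulomb_eq_zero f.continuous.measurable h0)
  -- Finiteness of T and D comes from the strict inequality: all factors are nonzero, so an infinite
  -- one would make its left side infinite.
  have hTtop : kinetic f ≠ ⊤ := by
    intro h0
    simp [h0, hD0, hCpos, ENNReal.top_mul, ENNReal.mul_top] at h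
  have hDtop : coulomb f ≠ ⊤ := by
    intro h0
    have : ENNReal.ofReal (27 * α / (16 * β ^ 3)) * kinetic f ^ 2 ≠ 0 :=
      mul_ne_zero hCpos (pow_ne_zero _ hT0)
    rw [h0, ENNReal.mul_top this] at h
    simp at h
  have hPtop := powerIntegral_ne_top f
  have hmass : 0 < ∫ x, ‖f x‖ ^ 2 := by
    have hi : Integrable (fun x => ‖f x‖ ^ 2) (volume : Measure R3) :=
      (f.memLp 2).integrable_norm_pow (by simp)
    refine lt_of_le_of_ne (integral_nonneg fun x => by positivity) fun h0 => hf0 ?_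
    rw [eq_comm, integral_eq_zero_iff_of_nonneg (fun x => by positivity) hi] at h0
    filter_upwards [h0] with x hx
    simpa using hx
  have hrP : 0 < (powerIntegral f).toReal := ENNReal.toReal_pos hP0 hPtop
  have hrT : 0 < (kinetic f).toReal := ENNReal.toReal_pos hT0 hTtop
  have hrD : 0 < (coulomb f).toReal := ENNReal.toReal_pos hD0 hDtop
  have hr : 27 * α * (kinetic f).toReal ^ 2 * (coulomb f).toReal
      < 16 * β ^ 3 * (powerIntegral f).toReal ^ 3 := by
    have := (ENNReal.toReal_lt_toReal (by finiteness) (by finiteness)).2 h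
    simp only [ENNReal.toReal_pow, ENNReal.toReal_mul] at this
    rw [ENNReal.toReal_ofReal (by positivity)] at this
    have e : 27 * α * (kinetic f).toReal ^ 2 * (coulomb f).toReal = 16 * β ^ 3 *
        (27 * α / (16 * β ^ 3) * (kinetic f).toReal ^ 2 * (coulomb f).toReal) := by field_simp
    rw [e]; gcongr
  obtain ⟨s, hs, hneg⟩ := exists_neg_of_cube_lt hα hβ hrT hrD hrP hr
  have hMtop := lintegral_fourier_sq_ne_top f
  have hP : powerIntegral f = ENNReal.ofReal (powerIntegral f).toReal :=
    (ENNReal.ofReal_toReal hPtop).symm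
  have hT : kinetic f = ENNReal.ofReal (kinetic f).toReal := (ENNReal.ofReal_toReal hTtop).symm
  have hD : coulomb f = ENNReal.ofReal (coulomb f).toReal := (ENNReal.ofReal_toReal hDtop).symm
  have hM := (ENNReal.ofReal_toReal hMtop).symm
  set P := (powerIntegral f).toReal
  set T := (kinetic f).toReal
  set D := (coulomb f).toReal
  set M := (∫⁻ ξ, ‖𝓕 (f : R3 → ℂ) ξ‖ₑ ^ 2).toReal
  have hM0 : 0 ≤ M := ENNReal.toReal_nonneg
  refine ⟨s ^ 3 * ∫ x, ‖f x‖ ^ 2, by positivity, ?_⟩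
  have main : ∀ l : ℝ, 0 < l → minEnergy (8 / 3) α β (s ^ 3 * ∫ x, ‖f x‖ ^ 2)
      ≤ ((1 / 2 * (s ^ 3 * (M + l * T)) + α * (s ^ 6 * l * D) - β * (s ^ 4 * l * P) : ℝ) :
        EReal) := by
    intro l hl
    -- With this amplitude the mass factor c²l⁻³ = s³ is free of l, while the Coulomb and power
    -- terms become s⁶lD and s⁴lP.
    set c := (s * l) ^ (3 / 2 : ℝ) with hcdef
    have hc : 0 ≤ c := by positivity
    have hc2 : c ^ 2 * (l ^ 3)⁻¹ = s ^ 3 := by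
      rw [hcdef, ← Real.rpow_natCast, ← Real.rpow_mul (by positivity)]
      norm_num
      field_simp
    have hc4 : c ^ 4 * (l ^ 5)⁻¹ = s ^ 6 * l := by
      rw [hcdef, ← Real.rpow_natCast, ← Real.rpow_mul (by positivity)]
      norm_num
      field_simp
    have hcp : c ^ (8 / 3 : ℝ) * (l ^ 3)⁻¹ = s ^ 4 * l := by
      rw [hcdef, ← Real.rpow_mul (by positivity)]
      norm_num
      field_simp
    have hae := (dilate c l hl.ne' f).coeFn_toLp 2 (volume : Measure R3)
    set u : L2 := (dilate c l hl.ne' f).toLp 2 (volume : Measure R3)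
    have hH : sobolevNormSq (1 / 2) u ≤ ENNReal.ofReal (s ^ 3 * (M + l * T)) := by
      refine (sobolevNormSq_dilate_le hc hl f).trans ?_
      rw [hc2, hT, hM, ← ENNReal.ofReal_mul hl.le, ← ENNReal.ofReal_add hM0 (by positivity),
        ← ENNReal.ofReal_mul (by positivity)]
    have hDu : coulomb u = ENNReal.ofReal (s ^ 6 * l * D) := by
      rw [coulomb_congr_ae hae, coulomb_dilate hc hl, hc4, hD, ← ENNReal.ofReal_mul (by positivity)]
    have hPu : ∫⁻ x, ‖u x‖ₑ ^ (8 / 3 : ℝ) = ENNReal.ofReal (s ^ 4 * l * P) := by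
      have : ∫⁻ x, ‖u x‖ₑ ^ (8 / 3 : ℝ) = powerIntegral (dilate c l hl.ne' f) :=
        powerIntegral_congr_ae hae
      rw [this, powerIntegral, lintegral_dilate_rpow hc hl f (by norm_num), hcp, ← powerIntegral,
        hP, ← ENNReal.ofReal_mul (by positivity)]
    have hmem : u ∈ sphere (s ^ 3 * ∫ x, ‖f x‖ ^ 2) := by
      refine ⟨hH.trans_lt ENNReal.ofReal_lt_top, ?_⟩
      rw [integral_norm_sq_dilate hl f, hc2]
    refine (iInf₂_le u hmem).trans ?_
    rw [energy, hDu, hPu, EReal.coe_ennreal_ofReal, EReal.coe_ennreal_ofReal,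
      max_eq_left (by positivity), max_eq_left (by positivity)]
    have hH' : (sobolevNormSq (1 / 2) u : EReal) ≤ ((s ^ 3 * (M + l * T) : ℝ) : EReal) := by
      have := EReal.coe_ennreal_le_coe_ennreal_iff.2 hH
      rwa [EReal.coe_ennreal_ofReal, max_eq_left (by positivity)] at this
    rw [EReal.coe_sub, EReal.coe_add, EReal.coe_mul, EReal.coe_mul, EReal.coe_mul]
    refine EReal.sub_le_sub (add_le_add_left ?_ _) le_rfl
    exact mul_le_mul_of_nonneg_left hH' (by exact_mod_cast (by norm_num : (0 : ℝ) ≤ 1 / 2))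
  rw [EReal.eq_bot_iff_forall_lt]
  intro y
  -- The bound of `main` is s³M/2 - lδ, so any l beyond (s³M/2 - y)/δ brings it below y.
  set δ := s ^ 3 * (β * s * P - (1 / 2 * T + α * s ^ 3 * D)) with hδ
  have hδ0 : 0 < δ := mul_pos (by positivity) (by linarith)
  obtain ⟨n, hn⟩ := exists_nat_gt ((1 / 2 * s ^ 3 * M - y) / δ)
  have hn' : (1 / 2 * s ^ 3 * M - y) / δ < (n + 1 : ℝ) := by linarith
  rw [div_lt_iff₀ hδ0] at hn'
  refine (main (n + 1) (by positivity)).trans_lt ?_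
  rw [EReal.coe_lt_coe_iff]
  rw [hδ] at hn'
  nlinarith

lemma exists_minEnergy_eq_bot_of_lt_bestConstant {α β : ℝ} (hα : 0 < α) (hβ : 0 < β)
    (h : ENNReal.ofReal ((27 * α / β ^ 3) ^ (1 / 8 : ℝ))
      < ENNReal.ofReal (Real.sqrt 2) * bestConstant) :
    ∃ ρ : ℝ, 0 < ρ ∧ minEnergy (8 / 3) α β ρ = ⊥ := by
  obtain ⟨φ, hφ, hc, hlt⟩ := exists_lt_of_lt_bestConstant hα hβ h
  exact exists_minEnergy_eq_bot hα hβ (hc.toSchwartzMap hφ) hlt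

/-! ### Plancherel, frequency splitting and the Gagliardo–Nirenberg inequality -/

lemma lintegral_sq_eq_eLpNorm_sq {f : R3 → ℂ} : ∫⁻ x, ‖f x‖ₑ ^ 2 = eLpNorm f 2 volume ^ 2 := by
  rw [eLpNorm_eq_lintegral_rpow_enorm_toReal (by simp) (by simp), ← ENNReal.rpow_natCast,
    ← ENNReal.rpow_mul]
  simp

lemma enorm_toLp (f : 𝓢(R3, ℂ)) : ‖f.toLp 2 (volume : Measure R3)‖ₑ = eLpNorm f 2 volume := by
  rw [Lp.enorm_def]
  exact eLpNorm_congr_ae (f.coeFn_toLp 2 volume)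

lemma lintegral_fourier_sq (f : 𝓢(R3, ℂ)) : ∫⁻ ξ, ‖𝓕 f ξ‖ₑ ^ 2 = ∫⁻ x, ‖f x‖ₑ ^ 2 := by
  rw [lintegral_sq_eq_eLpNorm_sq, lintegral_sq_eq_eLpNorm_sq, ← enorm_toLp, ← enorm_toLp,
    ← SchwartzMap.toLp_fourier_eq, ← ofReal_norm, ← ofReal_norm, Lp.norm_fourier_eq]

lemma lintegral_fourierInv_sq (f : 𝓢(R3, ℂ)) : ∫⁻ ξ, ‖𝓕⁻ f ξ‖ₑ ^ 2 = ∫⁻ x, ‖f x‖ₑ ^ 2 := by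
  rw [← lintegral_fourier_sq (𝓕⁻ f), fourier_fourierInv_eq]

lemma enorm_fourierInv_le (g : 𝓢(R3, ℂ)) (x : R3) : ‖𝓕⁻ g x‖ₑ ≤ ∫⁻ ξ, ‖g ξ‖ₑ := by
  rw [SchwartzMap.fourierInv_coe, Real.fourierInv_eq]
  refine (enorm_integral_le_lintegral_enorm _).trans (lintegral_mono fun ξ => ?_)
  rw [← ofReal_norm, ← ofReal_norm, Circle.norm_smul]

/-- A smooth splitting of a Schwartz function into frequencies below `2A` and above `A`. -/
lemma exists_frequency_splitting (f : 𝓢(R3, ℂ)) {A : ℝ} (hA : 0 < A) :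
    ∃ low high : 𝓢(R3, ℂ), f = low + high ∧
      (∀ x, ‖low x‖ₑ ≤ (volume (Metric.ball (0 : R3) (2 * A)) * ∫⁻ y, ‖f y‖ₑ ^ 2) ^ (1 / 2 : ℝ)) ∧
      ∫⁻ x, ‖high x‖ₑ ^ 2 ≤ ∫⁻ ξ, {ξ : R3 | A ≤ ‖ξ‖}.indicator (fun ξ => ‖𝓕 f ξ‖ₑ ^ 2) ξ := by
  let χ : ContDiffBump (0 : R3) := ⟨A, 2 * A, hA, by linarith⟩
  have hχ : Function.HasTemperateGrowth (χ : R3 → ℝ) :=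
    χ.hasCompactSupport.hasTemperateGrowth χ.contDiff
  set g := 𝓕 f with hg
  set gl : 𝓢(R3, ℂ) := SchwartzMap.smulLeftCLM ℂ (χ : R3 → ℝ) g
  have hgla : ∀ ξ, gl ξ = (χ ξ : ℝ) • g ξ := fun ξ => SchwartzMap.smulLeftCLM_apply_apply hχ g ξ
  refine ⟨𝓕⁻ gl, 𝓕⁻ (g - gl), ?_, ?_, ?_⟩
  · have : 𝓕⁻ gl + 𝓕⁻ (g - gl) = 𝓕⁻ (gl + (g - gl)) := (fourierInv_add _ _).symm
    rw [this, add_sub_cancel, hg, fourierInv_fourier_eq]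
  · intro x
    refine (enorm_fourierInv_le gl x).trans ?_
    -- The low part is bounded by the L¹ norm of its transform, which Cauchy–Schwarz on the ball of
    -- radius 2A converts to L².
    have hle : ∀ ξ, ‖gl ξ‖ₑ
        ≤ ((Metric.ball (0 : R3) (2 * A)).indicator (fun _ => (1 : ℝ≥0∞)) * fun ξ => ‖g ξ‖ₑ) ξ := by
      intro ξ
      by_cases hξ : ξ ∈ Metric.ball (0 : R3) (2 * A)
      · rw [hgla, enorm_smul, Pi.mul_apply, Set.indicator_of_mem hξ]
        gcongr
        rw [Real.enorm_eq_ofReal χ.nonneg]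
        exact ENNReal.ofReal_le_one.2 χ.le_one
      · have : χ ξ = 0 := by
          rw [← Function.notMem_support, χ.support_eq]; exact hξ
        rw [hgla, this]; simp
    refine (lintegral_mono hle).trans ?_
    refine (ENNReal.lintegral_mul_le_Lp_mul_Lq volume Real.HolderConjugate.two_two
      ((measurable_const.indicator Metric.isOpen_ball.measurableSet).aemeasurable)
      (g.continuous.measurable.enorm.aemeasurable)).trans ?_
    rw [ENNReal.mul_rpow_of_nonneg _ _ (by norm_num)]
    refine mul_le_mul' (ENNReal.rpow_le_rpow ?_ (by norm_num))
      (ENNReal.rpow_le_rpow ?_ (by norm_num))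
    · apply le_of_eq
      calc _ = ∫⁻ ξ, (Metric.ball (0 : R3) (2 * A)).indicator (fun _ => (1 : ℝ≥0∞)) ξ := by
            refine lintegral_congr fun ξ => ?_
            by_cases hξ : ξ ∈ Metric.ball (0 : R3) (2 * A) <;> simp [Set.indicator, hξ]
        _ = _ := by
          rw [lintegral_indicator Metric.isOpen_ball.measurableSet]; simp
    · rw [← lintegral_fourier_sq]
      simp [hg]
  · rw [lintegral_fourierInv_sq]
    refine lintegral_mono fun ξ => ?_
    have e : (g - gl) ξ = (1 - χ ξ : ℝ) • g ξ := by
      rw [sub_apply, hgla, sub_smul, one_smul]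
    rw [e]
    by_cases hξ : A ≤ ‖ξ‖
    · rw [Set.indicator_of_mem (by exact hξ), enorm_smul]
      have : ‖(1 - χ ξ : ℝ)‖ₑ ≤ 1 := by
        rw [Real.enorm_eq_ofReal (by linarith [χ.le_one (x := ξ)])]
        exact ENNReal.ofReal_le_one.2 (by linarith [χ.nonneg (x := ξ)])
      calc _ ≤ (1 * ‖g ξ‖ₑ) ^ 2 := by gcongr
        _ = _ := by rw [one_mul]
    · have : χ ξ = 1 := χ.one_of_mem_closedBall (by
        simp only [Metric.mem_closedBall, dist_zero_right, χ]
        linarith)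
      rw [this]; simp

/-- Cutting at frequency A = a t^{2/3} makes the volume of the ball of radius 2A proportional to t²,
so the smallness of a keeps the low part below t/2 at every height. Where |f| > t the high part is
then at least t/2, and Chebyshev applies. -/
lemma meas_lt_norm_le (f : 𝓢(R3, ℂ)) {a : ℝ} (ha : 0 < a)
    (hfa : volume (Metric.ball (0 : R3) 1) * ENNReal.ofReal (8 * a ^ 3) * ∫⁻ y, ‖f y‖ₑ ^ 2
      ≤ ENNReal.ofReal (1 / 4)) {t : ℝ} (ht : 0 < t) :
    volume {x | t < ‖f x‖} ≤ ENNReal.ofReal (4 / t ^ 2) *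
      ∫⁻ ξ, {ξ : R3 | a * t ^ (2 / 3 : ℝ) ≤ ‖ξ‖}.indicator (fun ξ => ‖𝓕 f ξ‖ₑ ^ 2) ξ := by
  set A := a * t ^ (2 / 3 : ℝ) with hAdef
  have hA : 0 < A := by positivity
  obtain ⟨low, high, hf, hlow, hhigh⟩ := exists_frequency_splitting f hA
  have hA3 : (2 * A) ^ 3 = 8 * a ^ 3 * t ^ 2 := by
    have : (t ^ (2 / 3 : ℝ)) ^ 3 = t ^ 2 := by
      rw [← Real.rpow_natCast, ← Real.rpow_mul ht.le]; norm_num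
    rw [hAdef, mul_pow, mul_pow, this]; ring
  have hlow' : ∀ x, ‖low x‖ ≤ t / 2 := by
    intro x
    have h1 : ‖low x‖ₑ ≤ ENNReal.ofReal (t / 2) := by
      refine (hlow x).trans ?_
      rw [Measure.addHaar_ball _ _ (by positivity), finrank_euclideanSpace_fin, hA3,
        ENNReal.ofReal_mul (by positivity)]
      have : ENNReal.ofReal (t / 2) = (ENNReal.ofReal (1 / 4) * ENNReal.ofReal (t ^ 2)) ^ (1 / 2 : ℝ) := by
        rw [← ENNReal.ofReal_mul (by positivity), ENNReal.ofReal_rpow_of_nonneg (by positivity)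
          (by positivity), show 1 / 4 * t ^ 2 = (t / 2) ^ 2 by ring, ← Real.sqrt_eq_rpow,
          Real.sqrt_sq (by positivity)]
      rw [this]
      refine ENNReal.rpow_le_rpow ?_ (by norm_num)
      calc _ = volume (Metric.ball (0 : R3) 1) * ENNReal.ofReal (8 * a ^ 3) * (∫⁻ y, ‖f y‖ₑ ^ 2)
            * ENNReal.ofReal (t ^ 2) := by ring
        _ ≤ _ := by gcongr
    rw [← ofReal_norm] at h1
    exact (ENNReal.ofReal_le_ofReal_iff (by positivity)).1 h1
  have hsub : {x | t < ‖f x‖} ⊆ {x | ENNReal.ofReal (t ^ 2 / 4) ≤ ‖high x‖ₑ ^ 2} := by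
    intro x hx
    have h1 : ‖f x‖ ≤ ‖low x‖ + ‖high x‖ := by
      rw [hf]; exact norm_add_le _ _
    have h2 : t / 2 ≤ ‖high x‖ := by
      have := hlow' x
      have : t < ‖f x‖ := hx
      linarith
    simp only [Set.mem_ofPred_eq]
    rw [← ofReal_norm, ← ENNReal.ofReal_pow (norm_nonneg _)]
    apply ENNReal.ofReal_le_ofReal
    nlinarith
  refine (measure_mono hsub).trans ?_
  refine (meas_ge_le_lintegral_div (by have := high.continuous.measurable; fun_prop)
    (by rw [← pos_iff_ne_zero, ENNReal.ofReal_pos]; positivity) (by simp)).trans ?_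
  rw [div_eq_mul_inv, ← ENNReal.ofReal_inv_of_pos (by positivity), inv_div, mul_comm]
  gcongr

lemma lintegral_Ioc_rpow {R : ℝ} (hR : 0 ≤ R) :
    ∫⁻ t in Set.Ioc 0 R, ENNReal.ofReal (t ^ (-1 / 3 : ℝ)) = ENNReal.ofReal (3 / 2 * R ^ (2 / 3 : ℝ)) := by
  have hi : IntervalIntegrable (fun t : ℝ => t ^ (-1 / 3 : ℝ)) volume 0 R :=
    intervalIntegral.intervalIntegrable_rpow' (by norm_num)
  rw [intervalIntegrable_iff_integrableOn_Ioc_of_le hR] at hi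
  rw [← ofReal_integral_eq_lintegral_ofReal hi, ← intervalIntegral.integral_of_le hR,
    integral_rpow (by norm_num)]
  · congr 1
    norm_num
    ring
  · filter_upwards [ae_restrict_mem measurableSet_Ioc] with t ht
    exact Real.rpow_nonneg ht.1.le _

/-- The Gagliardo–Nirenberg inequality `‖f‖_{8/3}^{8/3} ≤ C ‖f‖_2^{2/3} ‖f‖_{Ḣ^{1/2}}^2`, with a
free parameter. -/
lemma powerIntegral_le_of_amplitude (f : 𝓢(R3, ℂ)) {a : ℝ} (ha : 0 < a)
    (hfa : volume (Metric.ball (0 : R3) 1) * ENNReal.ofReal (8 * a ^ 3) * ∫⁻ y, ‖f y‖ₑ ^ 2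
      ≤ ENNReal.ofReal (1 / 4)) :
    powerIntegral f ≤ ENNReal.ofReal (16 / a) * kinetic f := by
  have hm : Measurable fun ξ => 𝓕 f ξ := (𝓕 f).continuous.measurable
  have hlc := lintegral_rpow_eq_lintegral_meas_lt_mul (volume : Measure R3) (f := fun x => ‖f x‖)
    (Filter.Eventually.of_forall fun x => norm_nonneg _) f.continuous.norm.aemeasurable
    (p := 8 / 3) (by norm_num)
  have hP : powerIntegral f = ∫⁻ x, ENNReal.ofReal (‖f x‖ ^ (8 / 3 : ℝ)) := by
    refine lintegral_congr fun x => ?_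
    rw [← ofReal_norm, ENNReal.ofReal_rpow_of_nonneg (norm_nonneg _) (by norm_num)]
  -- The layer cake weight t^{5/3} times the Chebyshev factor t⁻² leaves t^{-1/3}. Tonelli then
  -- integrates in t first, over t ≤ (|ξ|/a)^{3/2}, which produces the weight |ξ|.
  let F : ℝ → R3 → ℝ≥0∞ := fun t ξ =>
    ({p : ℝ × R3 | a * p.1 ^ (2 / 3 : ℝ) ≤ ‖p.2‖}.indicator
      (fun p => ENNReal.ofReal (p.1 ^ (-1 / 3 : ℝ)) * ‖𝓕 f p.2‖ₑ ^ 2) (t, ξ))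
  have hset : MeasurableSet {p : ℝ × R3 | a * p.1 ^ (2 / 3 : ℝ) ≤ ‖p.2‖} :=
    measurableSet_le (by fun_prop) (by fun_prop)
  have hF : Measurable (Function.uncurry F) := by
    have : Measurable fun p : ℝ × R3 => ENNReal.ofReal (p.1 ^ (-1 / 3 : ℝ)) * ‖𝓕 f p.2‖ₑ ^ 2 := by
      have h2 : Measurable fun p : ℝ × R3 => 𝓕 f p.2 := hm.comp measurable_snd
      fun_prop
    exact this.indicator hset
  have hin : ∀ ξ, ∫⁻ t in Set.Ioi 0, F t ξ
      = ENNReal.ofReal (3 / 2 / a) * (ENNReal.ofReal ‖ξ‖ * ‖𝓕 f ξ‖ₑ ^ 2) := by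
    intro ξ
    set R := (‖ξ‖ / a) ^ (3 / 2 : ℝ) with hR
    have hR0 : 0 ≤ R := by positivity
    have e : ∀ t ∈ Set.Ioi (0 : ℝ), F t ξ
        = (Set.Ioc 0 R).indicator (fun t => ENNReal.ofReal (t ^ (-1 / 3 : ℝ)) * ‖𝓕 f ξ‖ₑ ^ 2) t := by
      intro t ht
      have ht : 0 < t := ht
      have hiff : a * t ^ (2 / 3 : ℝ) ≤ ‖ξ‖ ↔ t ≤ R := by
        rw [mul_comm, ← le_div_iff₀ ha, hR]
        rw [← Real.rpow_le_rpow_iff (z := (3 / 2 : ℝ)) (by positivity) (by positivity)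
          (by norm_num), ← Real.rpow_mul ht.le]
        norm_num
      by_cases h : t ≤ R
      · simp [F, Set.indicator, hiff, h, ht]
      · simp [F, Set.indicator, hiff, h]
    rw [setLIntegral_congr_fun measurableSet_Ioi e, lintegral_indicator measurableSet_Ioc,
      Measure.restrict_restrict measurableSet_Ioc,
      Set.inter_eq_left.2 (fun t ht => ht.1), lintegral_mul_const'' _ (by fun_prop),
      lintegral_Ioc_rpow hR0, hR, ← Real.rpow_mul (by positivity), ← mul_assoc,
      ← ENNReal.ofReal_mul (by positivity), show (3 / 2 * (2 / 3) : ℝ) = 1 by norm_num,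
      Real.rpow_one]
    congr 2
    ring
  calc powerIntegral f
      = ENNReal.ofReal (8 / 3) * ∫⁻ t in Set.Ioi 0,
          volume {x | t < ‖f x‖} * ENNReal.ofReal (t ^ (8 / 3 - 1 : ℝ)) := by rw [hP, hlc]
    _ ≤ ENNReal.ofReal (8 / 3) * ∫⁻ t in Set.Ioi 0, ENNReal.ofReal 4 * ∫⁻ ξ, F t ξ := by
      refine mul_le_mul' le_rfl ?_
      refine setLIntegral_mono' measurableSet_Ioi fun t ht => ?_
      have ht : 0 < t := ht
      refine (mul_le_mul_left (meas_lt_norm_le f ha hfa ht) _).trans (le_of_eq ?_)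
      have e : ∫⁻ ξ, F t ξ = ENNReal.ofReal (t ^ (-1 / 3 : ℝ)) *
          ∫⁻ ξ, {ξ : R3 | a * t ^ (2 / 3 : ℝ) ≤ ‖ξ‖}.indicator (fun ξ => ‖𝓕 f ξ‖ₑ ^ 2) ξ := by
        rw [← lintegral_const_mul' _ _ (by simp)]
        refine lintegral_congr fun ξ => ?_
        by_cases h : a * t ^ (2 / 3 : ℝ) ≤ ‖ξ‖ <;> simp [F, Set.indicator, h]
      have e2 : 4 / t ^ 2 * t ^ (8 / 3 - 1 : ℝ) = 4 * t ^ (-1 / 3 : ℝ) := by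
        rw [div_mul_eq_mul_div, mul_div_assoc, ← Real.rpow_natCast, ← Real.rpow_sub ht]
        norm_num
      rw [e, ← mul_assoc, ← ENNReal.ofReal_mul (by norm_num), ← e2,
        ENNReal.ofReal_mul (by positivity)]
      ring
    _ = ENNReal.ofReal (8 / 3) * (ENNReal.ofReal 4 * ∫⁻ ξ, ∫⁻ t in Set.Ioi 0, F t ξ) := by
      rw [lintegral_const_mul' _ _ (by simp), lintegral_lintegral_swap hF.aemeasurable]
    _ = _ := by
      simp_rw [hin]
      rw [lintegral_const_mul' _ _ (by simp), ← mul_assoc, ← mul_assoc,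
        ← ENNReal.ofReal_mul (by norm_num), ← ENNReal.ofReal_mul (by norm_num), kinetic,
        SchwartzMap.fourier_coe]
      congr 2
      ring

/-- The Sobolev inequality `∫ |f|^{8/3} ≤ C ‖f‖_{H^{1/2}}^{8/3}` for Schwartz functions. -/
lemma exists_powerIntegral_le : ∃ C : ℝ, 0 < C ∧ ∀ (f : 𝓢(R3, ℂ)) (X : ℝ), 0 < X →
    sobolevNormSq (1 / 2) (f.toLp 2) ≤ ENNReal.ofReal X →
    powerIntegral f ≤ ENNReal.ofReal (C * X ^ (4 / 3 : ℝ)) := by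
  set v := (volume (Metric.ball (0 : R3) 1)).toReal with hv
  have hvtop : volume (Metric.ball (0 : R3) 1) ≠ ⊤ := measure_ball_lt_top.ne
  have hv0 : 0 < v :=
    ENNReal.toReal_pos (Metric.measure_ball_pos volume _ one_pos).ne' hvtop
  refine ⟨16 * (32 * v) ^ (1 / 3 : ℝ), by positivity, fun f X hX hH => ?_⟩
  rw [sobolevNormSq_toLp] at hH
  have hM : ∫⁻ y, ‖f y‖ₑ ^ 2 ≤ ENNReal.ofReal X := by
    rw [← lintegral_fourier_sq]
    refine le_trans (lintegral_mono fun ξ => ?_) hH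
    rw [SchwartzMap.fourier_coe]
    refine le_mul_of_one_le_left (by simp) ?_
    rw [ENNReal.one_le_ofReal]
    exact Real.one_le_rpow (by nlinarith [sq_nonneg ‖ξ‖]) (by norm_num)
  have hT : kinetic f ≤ ENNReal.ofReal X := by
    refine le_trans (lintegral_mono fun ξ => ?_) hH
    gcongr
    rw [← Real.sqrt_eq_rpow]
    exact Real.le_sqrt_of_sq_le (by linarith)
  -- Chosen so that v · 8a³ · X = 1/4, the largest a allowed when the mass is bounded by X.
  set a := ((32 * v * X) ^ (1 / 3 : ℝ))⁻¹ with ha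
  have ha0 : 0 < a := by positivity
  have ha3 : a ^ 3 = (32 * v * X)⁻¹ := by
    rw [ha, inv_pow, ← Real.rpow_natCast, ← Real.rpow_mul (by positivity)]; norm_num
  refine (powerIntegral_le_of_amplitude f ha0 ?_).trans ?_
  · calc _ ≤ ENNReal.ofReal v * ENNReal.ofReal (8 * a ^ 3) * ENNReal.ofReal X := by
          rw [hv, ENNReal.ofReal_toReal hvtop]; gcongr
      _ = _ := by
        rw [← ENNReal.ofReal_mul hv0.le, ← ENNReal.ofReal_mul (by positivity), ha3]
        congr 1
        field_simp
        norm_num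
  · calc _ ≤ ENNReal.ofReal (16 / a) * ENNReal.ofReal X := by gcongr
      _ = _ := by
        rw [← ENNReal.ofReal_mul (by positivity), ha, div_inv_eq_mul,
          Real.mul_rpow (by positivity) hX.le, show (4 / 3 : ℝ) = 1 / 3 + 1 by norm_num,
          Real.rpow_add hX, Real.rpow_one]
        ring_nf

/-! ### Density of test functions in the Sobolev space -/

/-- The function `(1 + |ξ|²)^{1/4} û(ξ)`, whose `L²` norm is the `H^{1/2}` norm of `u`. -/
def weightedFourier (u : L2) (ξ : R3) : ℂ := ((1 + ‖ξ‖ ^ 2) ^ (1 / 4 : ℝ) : ℝ) • (𝓕 u : L2) ξ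

lemma sobolevNormSq_eq_eLpNorm_sq (u : L2) :
    sobolevNormSq (1 / 2) u = eLpNorm (weightedFourier u) 2 volume ^ 2 := by
  rw [← lintegral_sq_eq_eLpNorm_sq, sobolevNormSq]
  refine lintegral_congr fun ξ => ?_
  rw [weightedFourier, enorm_smul, mul_pow, Real.enorm_eq_ofReal (by positivity),
    ← ENNReal.ofReal_pow (by positivity), ← Real.rpow_natCast (_ ^ (1 / 4 : ℝ)), ← Real.rpow_mul (by positivity)]
  norm_num

lemma aestronglyMeasurable_weightedFourier (u : L2) :
    AEStronglyMeasurable (weightedFourier u) volume := by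
  have h : Measurable fun ξ : R3 => (1 + ‖ξ‖ ^ 2) ^ (1 / 4 : ℝ) := by fun_prop
  exact h.aestronglyMeasurable.smul (Lp.aestronglyMeasurable _)

lemma weightedFourier_sub (u v : L2) :
    weightedFourier (u - v) =ᵐ[volume] weightedFourier u - weightedFourier v := by
  have h : (𝓕 (u - v) : L2) = 𝓕 u - 𝓕 v := (Lp.fourierTransformₗᵢ R3 ℂ).map_sub u v
  filter_upwards [Lp.coeFn_sub (𝓕 u : L2) (𝓕 v : L2)] with ξ hξ
  simp only [weightedFourier, h, Pi.sub_apply]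
  rw [hξ, Pi.sub_apply, smul_sub]

lemma weightedFourier_toLp_fourierInv (k : 𝓢(R3, ℂ)) :
    weightedFourier ((𝓕⁻ k).toLp 2 volume) =ᵐ[volume]
      fun ξ => ((1 + ‖ξ‖ ^ 2) ^ (1 / 4 : ℝ) : ℝ) • k ξ := by
  have e : (𝓕 ((𝓕⁻ k).toLp 2 (volume : Measure R3)) : L2) = k.toLp 2 volume := by
    rw [SchwartzMap.toLp_fourier_eq, fourier_fourierInv_eq]
  filter_upwards [k.coeFn_toLp 2 volume] with ξ hξ
  rw [weightedFourier, e, hξ]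

lemma contDiff_weight_rpow (s : ℝ) : ContDiff ℝ ∞ fun ξ : R3 => (1 + ‖ξ‖ ^ 2) ^ s :=
  (contDiff_const.add (contDiff_norm_sq ℝ)).rpow_const_of_ne fun ξ =>
    (add_pos_of_pos_of_nonneg one_pos (sq_nonneg ‖ξ‖)).ne'

lemma exists_schwartz_weight_smul {h : R3 → ℂ} (hc : HasCompactSupport h) (hs : ContDiff ℝ ∞ h)
    (s : ℝ) : ∃ k : 𝓢(R3, ℂ), ∀ ξ, k ξ = ((1 + ‖ξ‖ ^ 2) ^ s : ℝ) • h ξ := by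
  have hkc : HasCompactSupport fun ξ : R3 => ((1 + ‖ξ‖ ^ 2) ^ s : ℝ) • h ξ :=
    hc.mono fun ξ hξ => by
      contrapose! hξ
      rw [Function.notMem_support] at hξ ⊢
      rw [hξ, smul_zero]
  exact ⟨hkc.toSchwartzMap ((contDiff_weight_rpow s).smul hs), fun ξ => rfl⟩

/-- Schwartz functions are dense in `H^{1/2}`. -/
lemma exists_schwartz_approx (u : L2) (hu : sobolevNormSq (1 / 2) u < ⊤) {ε : ℝ} (hε : 0 < ε) :
    ∃ f : 𝓢(R3, ℂ),
      eLpNorm (weightedFourier (u - f.toLp 2 volume)) 2 volume ≤ ENNReal.ofReal ε := by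
  have hmem : MemLp (weightedFourier u) 2 volume := by
    refine ⟨aestronglyMeasurable_weightedFourier u, ?_⟩
    rw [sobolevNormSq_eq_eLpNorm_sq] at hu
    exact (ENNReal.pow_lt_top_iff.1 hu).resolve_right (by norm_num)
  obtain ⟨h, hc, hs, hle⟩ := hmem.exist_eLpNorm_sub_le (by simp) (by simp) hε
  -- Removing the smooth positive weight from the L² approximant h keeps it smooth and compactly
  -- supported, so its inverse transform is Schwartz.
  obtain ⟨k, hk⟩ := exists_schwartz_weight_smul hc hs (-(1 / 4))
  refine ⟨𝓕⁻ k, le_trans (le_of_eq (eLpNorm_congr_ae ?_)) hle⟩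
  filter_upwards [weightedFourier_sub u ((𝓕⁻ k).toLp 2 volume),
    weightedFourier_toLp_fourierInv k] with ξ h1 h2
  rw [h1, Pi.sub_apply, Pi.sub_apply, h2, hk, smul_smul, ← Real.rpow_add (by positivity)]
  simp

/-- The standard basis of `ℝ³`. -/
def basisVec (i : Fin 3) : R3 := EuclideanSpace.single i 1

/-- Differentiation multiplies the transform by 2πiξᵢ, and 2π ≥ 1 is simply discarded. -/
lemma lintegral_lineDeriv_sq (v : 𝓢(R3, ℂ)) (i : Fin 3) :
    ∫⁻ ξ, ENNReal.ofReal (ξ i ^ 2) * ‖𝓕 v ξ‖ₑ ^ 2 ≤ ∫⁻ x, ‖(∂_{basisVec i} v) x‖ₑ ^ 2 := by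
  rw [← lintegral_fourier_sq (∂_{basisVec i} v)]
  refine lintegral_mono fun ξ => ?_
  have hg : Function.HasTemperateGrowth fun x : R3 => inner ℝ x (basisVec i) := by fun_prop
  rw [SchwartzMap.fourier_lineDerivOp_eq, smul_apply,
    SchwartzMap.smulLeftCLM_apply_apply hg, enorm_smul, enorm_smul, mul_pow, mul_pow]
  have h1 : inner ℝ ξ (basisVec i) = ξ i := by simp [basisVec, EuclideanSpace.inner_single_right]
  have h2 : ‖ξ i‖ₑ ^ 2 = ENNReal.ofReal (ξ i ^ 2) := by
    rw [← ofReal_norm, ← ENNReal.ofReal_pow (norm_nonneg _), Real.norm_eq_abs, sq_abs]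
  rw [h1, h2]
  refine le_mul_of_one_le_left (by simp) (one_le_pow₀ ?_)
  rw [← ofReal_norm, ENNReal.one_le_ofReal]
  simp only [norm_mul, Complex.norm_I, Complex.norm_real, Complex.norm_ofNat,
    Real.norm_of_nonneg Real.pi_pos.le]
  linarith [Real.pi_gt_three]

/-- The `H^{1/2}` norm is controlled by the `H¹` norm. -/
lemma sobolevNormSq_le_lineDeriv (v : 𝓢(R3, ℂ)) :
    sobolevNormSq (1 / 2) (v.toLp 2)
      ≤ (∫⁻ x, ‖v x‖ₑ ^ 2) + ∑ i, ∫⁻ x, ‖(∂_{basisVec i} v) x‖ₑ ^ 2 := by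
  have hm : Measurable fun ξ => 𝓕 v ξ := (𝓕 v).continuous.measurable
  calc _ ≤ ∫⁻ ξ, (‖𝓕 v ξ‖ₑ ^ 2 + ∑ i, ENNReal.ofReal (ξ i ^ 2) * ‖𝓕 v ξ‖ₑ ^ 2) := by
        rw [sobolevNormSq_toLp, ← SchwartzMap.fourier_coe]
        refine lintegral_mono fun ξ => ?_
        dsimp only
        rw [← Finset.sum_mul, ← ENNReal.ofReal_sum_of_nonneg fun i _ => sq_nonneg _,
          ← one_add_mul, ← ENNReal.ofReal_one,
          ← ENNReal.ofReal_add (by norm_num) (Finset.sum_nonneg fun i _ => sq_nonneg _)]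
        gcongr
        have : ‖ξ‖ ^ 2 = ∑ i, ξ i ^ 2 := EuclideanSpace.real_norm_sq_eq ξ
        rw [← this]
        calc _ ≤ (1 + ‖ξ‖ ^ 2) ^ (1 : ℝ) :=
              Real.rpow_le_rpow_of_exponent_le (by nlinarith [sq_nonneg ‖ξ‖]) (by norm_num)
          _ = _ := Real.rpow_one _
    _ = (∫⁻ ξ, ‖𝓕 v ξ‖ₑ ^ 2) + ∑ i, ∫⁻ ξ, ENNReal.ofReal (ξ i ^ 2) * ‖𝓕 v ξ‖ₑ ^ 2 := by
        rw [lintegral_add_left (by fun_prop), lintegral_finsetSum _ (fun i _ => by fun_prop)]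
    _ ≤ _ := by
        rw [lintegral_fourier_sq]
        refine add_le_add le_rfl (Finset.sum_le_sum fun i _ => ?_)
        exact lintegral_lineDeriv_sq v i

/-- Smooth cutoff functions with uniformly bounded derivative which are eventually equal to one
near every point. -/
lemma exists_cutoff : ∃ (χ : ℕ → R3 → ℝ) (C : ℝ), 0 ≤ C ∧ (∀ n, ContDiff ℝ ∞ (χ n)) ∧
    (∀ n, HasCompactSupport (χ n)) ∧ (∀ n x, 0 ≤ χ n x) ∧ (∀ n x, χ n x ≤ 1) ∧
    (∀ n x, ‖fderiv ℝ (χ n) x‖ ≤ C) ∧ ∀ x, ∀ᶠ n in atTop, χ n =ᶠ[𝓝 x] 1 := by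
  let χ : ContDiffBump (0 : R3) := ⟨1, 2, one_pos, by norm_num⟩
  obtain ⟨C, hC⟩ := (χ.hasCompactSupport.fderiv ℝ).exists_bound_of_continuous
    ((χ.contDiff (n := ⊤)).continuous_fderiv (by simp))
  have hC0 : 0 ≤ C := (norm_nonneg _).trans (hC 0)
  refine ⟨fun n x => χ (((n : ℝ) + 1)⁻¹ • x), C, hC0, fun n => ?_, fun n => ?_,
    fun n x => χ.nonneg, fun n x => χ.le_one, fun n x => ?_, fun x => ?_⟩
  · exact χ.contDiff.comp (by fun_prop)
  · exact χ.hasCompactSupport.comp_smul (by positivity)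
  · rw [fderiv_comp_smul, norm_smul, norm_inv, Real.norm_of_nonneg (by positivity)]
    calc _ ≤ 1 * C := by
          gcongr
          · exact inv_le_one_of_one_le₀ (by linarith [(Nat.cast_nonneg n : (0 : ℝ) ≤ n)])
          · exact hC _
      _ = C := one_mul C
  · obtain ⟨N, hN⟩ := exists_nat_gt ‖x‖
    filter_upwards [eventually_ge_atTop N] with n hn
    have hx : ‖x‖ < (n : ℝ) + 1 := by
      have : (N : ℝ) ≤ n := by exact_mod_cast hn
      linarith
    filter_upwards [(isOpen_lt continuous_norm continuous_const).mem_nhds hx] with y hy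
    refine χ.one_of_mem_closedBall ?_
    have hy : ‖y‖ < (n : ℝ) + 1 := hy
    simp only [Metric.mem_closedBall, dist_zero_right, norm_smul, norm_inv, χ]
    rw [Real.norm_of_nonneg (by positivity), inv_mul_le_iff₀ (by positivity)]
    linarith

lemma tendsto_lintegral_enorm_sq {F : ℕ → R3 → ℂ} {b : R3 → ℝ} (hF : ∀ n, Measurable (F n))
    (hb : MemLp b 2 volume) (hle : ∀ n x, ‖F n x‖ ≤ b x) (h0 : ∀ x, ∀ᶠ n in atTop, F n x = 0) :
    Tendsto (fun n => ∫⁻ x, ‖F n x‖ₑ ^ 2) atTop (𝓝 0) := by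
  have := tendsto_lintegral_of_dominated_convergence (μ := volume)
    (F := fun n x => ‖F n x‖ₑ ^ 2) (f := fun _ => 0)
    (fun x => ‖b x‖ₑ ^ 2) (fun n => by have := hF n; fun_prop) (fun n => ?_) ?_ ?_
  · simpa using this
  · refine Eventually.of_forall fun x => ?_
    dsimp only
    gcongr
    rw [← ofReal_norm, ← ofReal_norm]
    exact ENNReal.ofReal_le_ofReal ((hle n x).trans (le_abs_self _))
  · have h := hb.2
    rw [eLpNorm_lt_top_iff_lintegral_rpow_enorm_lt_top (by simp) (by simp)] at h
    simpa using h.ne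
  · refine Eventually.of_forall fun x => ?_
    refine tendsto_const_nhds.congr' ?_
    filter_upwards [h0 x] with n hn
    simp [hn]

/-- Compactly supported smooth functions are dense in the Schwartz functions, for the `H^{1/2}`
norm. -/
lemma exists_compactSupport_approx_schwartz (f : 𝓢(R3, ℂ)) {ε : ℝ≥0∞} (hε : 0 < ε) :
    ∃ g : 𝓢(R3, ℂ), HasCompactSupport g ∧ sobolevNormSq (1 / 2) ((f - g).toLp 2 volume) < ε := by
  obtain ⟨χ, C, hC, hs, hc, h0, h1, hd, hev⟩ := exists_cutoff
  have hχ : ∀ n, Function.HasTemperateGrowth (χ n) := fun n => (hc n).hasTemperateGrowth (hs n)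
  let g : ℕ → 𝓢(R3, ℂ) := fun n => SchwartzMap.smulLeftCLM ℂ (χ n) f
  have hg : ∀ n, ⇑(g n) = fun x => χ n x • f x := fun n =>
    funext fun x => SchwartzMap.smulLeftCLM_apply_apply (hχ n) f x
  have hgc : ∀ n, HasCompactSupport (g n) := fun n => by rw [hg]; exact (hc n).smul_right
  have hv : ∀ n, ⇑(f - g n) = fun x => (1 - χ n x) • f x := fun n => by
    funext x
    rw [sub_apply, hg, sub_smul, one_smul]
  -- Vanishing on a neighbourhood, not just at x, makes the derivatives vanish eventually as well.
  have hev0 : ∀ x, ∀ᶠ n in atTop, ⇑(f - g n) =ᶠ[𝓝 x] 0 := by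
    intro x
    filter_upwards [hev x] with n hn
    filter_upwards [hn] with y hy
    rw [hv]; simp [hy]
  have t0 : Tendsto (fun n => ∫⁻ x, ‖(f - g n) x‖ₑ ^ 2) atTop (𝓝 0) := by
    refine tendsto_lintegral_enorm_sq (fun n => (f - g n).continuous.measurable)
      (f.memLp 2).norm (fun n x => ?_) fun x => ?_
    · rw [hv]
      dsimp only
      rw [norm_smul, Real.norm_of_nonneg (by linarith [h1 n x])]
      exact mul_le_of_le_one_left (norm_nonneg _) (by linarith [h0 n x])
    · filter_upwards [hev0 x] with n hn using hn.self_of_nhds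
  have t1 : ∀ i, Tendsto (fun n => ∫⁻ x, ‖(∂_{basisVec i} (f - g n)) x‖ₑ ^ 2) atTop (𝓝 0) := by
    intro i
    refine tendsto_lintegral_enorm_sq (b := fun x => ‖(∂_{basisVec i} f) x‖ + C * ‖f x‖)
      (fun n => (∂_{basisVec i} (f - g n)).continuous.measurable)
      (((∂_{basisVec i} f).memLp 2).norm.add ((f.memLp 2).norm.const_mul C)) (fun n x => ?_) fun x => ?_
    · rw [SchwartzMap.lineDerivOp_apply_eq_fderiv, SchwartzMap.lineDerivOp_apply_eq_fderiv, hv]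
      have hdχ : DifferentiableAt ℝ (fun x => 1 - χ n x) x :=
        ((hs n).differentiable (by simp) x).const_sub 1
      rw [fderiv_fun_smul hdχ f.differentiableAt]
      have e1 : fderiv ℝ (fun x => 1 - χ n x) x = -fderiv ℝ (χ n) x := fderiv_const_sub 1
      simp only [e1, add_apply, smul_apply,
        ContinuousLinearMap.smulRight_apply, neg_apply]
      refine (norm_add_le _ _).trans (add_le_add ?_ ?_)
      · rw [norm_smul, Real.norm_of_nonneg (by linarith [h1 n x])]
        exact mul_le_of_le_one_left (norm_nonneg _) (by linarith [h0 n x])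
      · rw [norm_smul, norm_neg]
        gcongr
        refine ((fderiv ℝ (χ n) x).le_opNorm _).trans ?_
        simpa [basisVec] using hd n x
    · filter_upwards [hev0 x] with n hn
      rw [SchwartzMap.lineDerivOp_apply_eq_fderiv, hn.fderiv_eq]
      simp
  have tt : Tendsto (fun n => (∫⁻ x, ‖(f - g n) x‖ₑ ^ 2)
      + ∑ i, ∫⁻ x, ‖(∂_{basisVec i} (f - g n)) x‖ₑ ^ 2) atTop (𝓝 0) := by
    simpa using t0.add (tendsto_finsetSum Finset.univ fun i _ => t1 i)
  obtain ⟨n, hn⟩ := (tt.eventually (gt_mem_nhds hε)).exists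
  exact ⟨g n, hgc n, (sobolevNormSq_le_lineDeriv _).trans_lt hn⟩

/-- Compactly supported smooth functions are dense in `H^{1/2}`. -/
lemma exists_compactSupport_approx (u : L2) (hu : sobolevNormSq (1 / 2) u < ⊤) {ε : ℝ}
    (hε : 0 < ε) : ∃ f : 𝓢(R3, ℂ), HasCompactSupport f ∧
      eLpNorm (weightedFourier (u - f.toLp 2 volume)) 2 volume ≤ ENNReal.ofReal ε := by
  obtain ⟨f, hf⟩ := exists_schwartz_approx u hu (half_pos hε)
  have hε2 : 0 < ENNReal.ofReal (ε / 2) ^ 2 := by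
    apply ENNReal.pow_pos
    rw [ENNReal.ofReal_pos]; linarith
  obtain ⟨g, hg, hfg⟩ := exists_compactSupport_approx_schwartz f hε2
  refine ⟨g, hg, ?_⟩
  rw [sobolevNormSq_eq_eLpNorm_sq] at hfg
  have hfg' := (ENNReal.pow_le_pow_left_iff (n := 2) (by norm_num)).1 hfg.le
  have hsub : (f - g).toLp 2 (volume : Measure R3) = f.toLp 2 volume - g.toLp 2 volume :=
    (SchwartzMap.toLpCLM ℝ ℂ 2 volume).map_sub f g
  have hadd : weightedFourier (u - g.toLp 2 volume) =ᵐ[volume]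
      weightedFourier (u - f.toLp 2 volume) + weightedFourier ((f - g).toLp 2 volume) := by
    rw [hsub]
    filter_upwards [weightedFourier_sub u (g.toLp 2 volume), weightedFourier_sub u (f.toLp 2 volume),
      weightedFourier_sub (f.toLp 2 volume) (g.toLp 2 volume)] with x h1 h2 h3
    rw [h1, Pi.add_apply, h2, h3]
    simp
  rw [eLpNorm_congr_ae hadd]
  refine (eLpNorm_add_le (aestronglyMeasurable_weightedFourier _)
    (aestronglyMeasurable_weightedFourier _) (by simp)).trans ?_
  calc _ ≤ ENNReal.ofReal (ε / 2) + ENNReal.ofReal (ε / 2) := add_le_add hf hfg'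
    _ = _ := by rw [← ENNReal.ofReal_add (by linarith) (by linarith), add_halves]

/-! ### Bounds for the Coulomb energy -/

/-- The Coulomb interaction energy of the densities `a²` and `b²`. -/
def mixedCoulomb (a b : R3 → ℝ≥0∞) : ℝ≥0∞ :=
  ∫⁻ p : R3 × R3, a p.1 ^ 2 * b p.2 ^ 2 * ‖p.1 - p.2‖ₑ⁻¹

lemma coulomb_eq_mixedCoulomb {f : R3 → ℂ} (hf : Measurable f) :
    coulomb f = mixedCoulomb (fun x => ‖f x‖ₑ) (fun x => ‖f x‖ₑ) := by
  rw [mixedCoulomb, Measure.volume_eq_prod, lintegral_prod _ (by fun_prop)]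
  rfl

lemma lintegral_mul_le_sqrt_mul_sqrt {Ω : Type*} [MeasurableSpace Ω] (μ : Measure Ω)
    {f g : Ω → ℝ≥0∞} (hf : Measurable f) (hg : Measurable g) :
    ∫⁻ x, f x * g x ∂μ
      ≤ (∫⁻ x, f x ^ 2 ∂μ) ^ (1 / 2 : ℝ) * (∫⁻ x, g x ^ 2 ∂μ) ^ (1 / 2 : ℝ) := by
  have := ENNReal.lintegral_mul_le_Lp_mul_Lq μ Real.HolderConjugate.two_two hf.aemeasurable
    hg.aemeasurable
  simpa using this

/-- The singular part of the Coulomb kernel. -/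
def localKernel (z : R3) : ℝ≥0∞ := (Metric.ball (0 : R3) 1).indicator (fun z => ‖z‖ₑ⁻¹) z

@[fun_prop]
lemma measurable_localKernel : Measurable localKernel :=
  Measurable.indicator (by fun_prop) Metric.isOpen_ball.measurableSet

lemma inv_enorm_le (z : R3) : ‖z‖ₑ⁻¹ ≤ 1 + localKernel z := by
  by_cases h : z ∈ Metric.ball (0 : R3) 1
  · rw [localKernel, Set.indicator_of_mem h]
    exact le_add_self
  · refine le_add_right ?_
    rw [ENNReal.inv_le_one, ← ofReal_norm, ENNReal.one_le_ofReal]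
    simpa using h

/-- In polar coordinates the Jacobian r² of dimension three cancels the singularity r⁻². -/
lemma lintegral_localKernel_sq_ne_top : ∫⁻ z, localKernel z ^ 2 ≠ ⊤ := by
  have hi : IntegrableOn (fun z : R3 => (fun y : ℝ => (y ^ 2)⁻¹) ‖z‖) (Metric.ball 0 1) := by
    rw [integrableOn_fun_norm_addHaar volume (f := fun y : ℝ => (y ^ 2)⁻¹),
      finrank_euclideanSpace_fin, integrableOn_congr_fun (g := fun _ => (1 : ℝ)) _ measurableSet_Ioo]
    · exact integrableOn_const (by simp)
    · intro y hy
      have : y ≠ 0 := hy.1.ne'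
      simp [this]
  have h2 := hi.2
  rw [HasFiniteIntegral] at h2
  refine ne_of_lt (lt_of_le_of_lt ?_ h2)
  rw [← lintegral_indicator Metric.isOpen_ball.measurableSet]
  refine lintegral_mono_ae ?_
  filter_upwards [Measure.ae_ne volume (0 : R3)] with z hz
  by_cases h : z ∈ Metric.ball (0 : R3) 1
  · have hz' : 0 < ‖z‖ := norm_pos_iff.2 hz
    rw [localKernel, Set.indicator_of_mem h, Set.indicator_of_mem h, Real.enorm_eq_ofReal (by positivity),
      ENNReal.ofReal_inv_of_pos (by positivity), ENNReal.ofReal_pow (by positivity), ofReal_norm,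
      ENNReal.inv_pow]
  · simp [localKernel, h]

lemma lintegral_mul_localKernel_sq {a : R3 → ℝ≥0∞} (ha : Measurable a) :
    ∫⁻ p : R3 × R3, a p.1 * localKernel (p.1 - p.2) ^ 2
      = (∫⁻ x, a x) * ∫⁻ z, localKernel z ^ 2 := by
  rw [Measure.volume_eq_prod, lintegral_prod _ (by fun_prop)]
  have : ∀ x, ∫⁻ y, a x * localKernel (x - y) ^ 2 = a x * ∫⁻ z, localKernel z ^ 2 := by
    intro x
    rw [lintegral_const_mul _ (by fun_prop),
      lintegral_sub_left_eq_self (fun z => localKernel z ^ 2) x]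
  simp only [this]
  rw [lintegral_mul_const _ ha]

lemma lintegral_mul_localKernel_sq' {b : R3 → ℝ≥0∞} (hb : Measurable b) :
    ∫⁻ p : R3 × R3, b p.2 * localKernel (p.1 - p.2) ^ 2
      = (∫⁻ x, b x) * ∫⁻ z, localKernel z ^ 2 := by
  rw [Measure.volume_eq_prod, lintegral_prod_symm _ (by fun_prop)]
  have : ∀ y, ∫⁻ x, b y * localKernel (x - y) ^ 2 = b y * ∫⁻ z, localKernel z ^ 2 := by
    intro y
    rw [lintegral_const_mul _ (by fun_prop),
      lintegral_sub_right_eq_self (fun z => localKernel z ^ 2) y]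
  simp only [this]
  rw [lintegral_mul_const _ hb]

lemma rpow_mul_rpow_sq (x : ℝ≥0∞) {s t : ℝ} (hs : s * 2 = t) : (x ^ s) ^ 2 = x ^ t := by
  rw [← ENNReal.rpow_natCast, ← ENNReal.rpow_mul]
  norm_num [hs]

/-- A form of the Hardy–Littlewood–Sobolev inequality for the Coulomb kernel. -/
lemma mixedCoulomb_le {a b : R3 → ℝ≥0∞} (ha : Measurable a) (hb : Measurable b) :
    mixedCoulomb a b ≤ (∫⁻ x, a x ^ 2) * (∫⁻ x, b x ^ 2)
      + ((∫⁻ x, a x ^ (8 / 3 : ℝ)) * ∫⁻ x, b x ^ (8 / 3 : ℝ)) ^ (1 / 2 : ℝ) *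
        (((∫⁻ x, a x ^ (8 / 3 : ℝ)) * ∫⁻ z, localKernel z ^ 2) ^ (1 / 2 : ℝ) *
          ((∫⁻ x, b x ^ (8 / 3 : ℝ)) * ∫⁻ z, localKernel z ^ 2) ^ (1 / 2 : ℝ)) ^ (1 / 2 : ℝ) := by
  have hsplit : ∀ (x : ℝ≥0∞), x ^ 2 = x ^ (4 / 3 : ℝ) * x ^ (2 / 3 : ℝ) := by
    intro x
    rw [← ENNReal.rpow_add_of_nonneg _ _ (by norm_num) (by norm_num), ← ENNReal.rpow_natCast]
    norm_num
  have hk : Measurable fun p : R3 × R3 => localKernel (p.1 - p.2) := by fun_prop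
  have hloc : ∫⁻ p : R3 × R3, a p.1 ^ 2 * b p.2 ^ 2 * localKernel (p.1 - p.2)
      ≤ ((∫⁻ x, a x ^ (8 / 3 : ℝ)) * ∫⁻ x, b x ^ (8 / 3 : ℝ)) ^ (1 / 2 : ℝ) *
        (((∫⁻ x, a x ^ (8 / 3 : ℝ)) * ∫⁻ z, localKernel z ^ 2) ^ (1 / 2 : ℝ) *
          ((∫⁻ x, b x ^ (8 / 3 : ℝ)) * ∫⁻ z, localKernel z ^ 2) ^ (1 / 2 : ℝ)) ^ (1 / 2 : ℝ) := by
    -- Cauchy–Schwarz is used twice, here and on a^{4/3}k · b^{4/3}k with k the local kernel, so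
    -- that only the 8/3 powers of a and b and the integral of k² occur.
    calc _ = ∫⁻ p : R3 × R3, (a p.1 ^ (4 / 3 : ℝ) * b p.2 ^ (4 / 3 : ℝ)) *
          (a p.1 ^ (2 / 3 : ℝ) * b p.2 ^ (2 / 3 : ℝ) * localKernel (p.1 - p.2)) := by
          refine lintegral_congr fun p => ?_
          rw [hsplit (a p.1), hsplit (b p.2)]
          ring
      _ ≤ _ := lintegral_mul_le_sqrt_mul_sqrt _ (by fun_prop) (by fun_prop)
      _ ≤ _ := by
        refine mul_le_mul' (ENNReal.rpow_le_rpow (le_of_eq ?_) (by norm_num))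
          (ENNReal.rpow_le_rpow ?_ (by norm_num))
        · simp only [mul_pow, rpow_mul_rpow_sq _ (show (4 / 3 : ℝ) * 2 = 8 / 3 by norm_num)]
          rw [Measure.volume_eq_prod, lintegral_prod_mul (f := fun x => a x ^ (8 / 3 : ℝ))
            (g := fun x => b x ^ (8 / 3 : ℝ)) (by fun_prop) (by fun_prop)]
        · calc _ = ∫⁻ p : R3 × R3, (a p.1 ^ (4 / 3 : ℝ) * localKernel (p.1 - p.2)) *
              (b p.2 ^ (4 / 3 : ℝ) * localKernel (p.1 - p.2)) := by
                refine lintegral_congr fun p => ?_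
                simp only [mul_pow, rpow_mul_rpow_sq _ (show (2 / 3 : ℝ) * 2 = 4 / 3 by norm_num)]
                ring
            _ ≤ _ := lintegral_mul_le_sqrt_mul_sqrt _ (by fun_prop) (by fun_prop)
            _ = _ := by
              simp only [mul_pow, rpow_mul_rpow_sq _ (show (4 / 3 : ℝ) * 2 = 8 / 3 by norm_num)]
              rw [lintegral_mul_localKernel_sq (a := fun x => a x ^ (8 / 3 : ℝ)) (by fun_prop),
                lintegral_mul_localKernel_sq' (b := fun x => b x ^ (8 / 3 : ℝ)) (by fun_prop)]
  calc mixedCoulomb a b ≤ ∫⁻ p : R3 × R3, (a p.1 ^ 2 * b p.2 ^ 2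
        + a p.1 ^ 2 * b p.2 ^ 2 * localKernel (p.1 - p.2)) := by
        refine lintegral_mono fun p => ?_
        calc _ ≤ a p.1 ^ 2 * b p.2 ^ 2 * (1 + localKernel (p.1 - p.2)) :=
              mul_le_mul' le_rfl (inv_enorm_le _)
          _ = _ := by ring
    _ = (∫⁻ x, a x ^ 2) * (∫⁻ x, b x ^ 2)
        + ∫⁻ p : R3 × R3, a p.1 ^ 2 * b p.2 ^ 2 * localKernel (p.1 - p.2) := by
        rw [lintegral_add_left (by fun_prop)]
        congr 1
        rw [Measure.volume_eq_prod, lintegral_prod_mul (f := fun x => a x ^ 2)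
            (g := fun x => b x ^ 2) (by fun_prop) (by fun_prop)]
    _ ≤ _ := add_le_add le_rfl hloc

/-- Minkowski's inequality for the Coulomb energy. -/
lemma sqrt_coulomb_le {f u : R3 → ℂ} (hf : Measurable f) (hu : Measurable u) :
    coulomb f ^ (1 / 2 : ℝ) ≤ coulomb u ^ (1 / 2 : ℝ)
      + mixedCoulomb (fun x => ‖u x‖ₑ) (fun x => ‖u x - f x‖ₑ) ^ (1 / 2 : ℝ)
      + mixedCoulomb (fun x => ‖u x - f x‖ₑ) (fun x => ‖f x‖ₑ) ^ (1 / 2 : ℝ) := by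
  -- With the square root of the kernel absorbed, the energies are squared L² norms on the product
  -- space. Minkowski is applied to |f(x)f(y)| ≤ |u(x)u(y)| + |u(x)||(u-f)(y)| + |(u-f)(x)||f(y)|.
  let A : (R3 → ℝ≥0∞) → (R3 → ℝ≥0∞) → R3 × R3 → ℝ≥0∞ :=
    fun a b p => a p.1 * b p.2 * ‖p.1 - p.2‖ₑ⁻¹ ^ (1 / 2 : ℝ)
  have hA : ∀ a b, mixedCoulomb a b = ∫⁻ p, A a b p ^ (2 : ℝ) := by
    intro a b
    refine lintegral_congr fun p => ?_
    simp only [A, ENNReal.rpow_two, mul_pow, rpow_mul_rpow_sq _ (show (1 / 2 : ℝ) * 2 = 1 by norm_num),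
      ENNReal.rpow_one]
  have hm : ∀ {a b : R3 → ℝ≥0∞}, Measurable a → Measurable b → Measurable (A a b) := by
    intro a b ha hb
    simp only [A]
    fun_prop
  rw [coulomb_eq_mixedCoulomb hf, coulomb_eq_mixedCoulomb hu]
  simp only [hA]
  have h1 := hm hu.enorm hu.enorm
  have h2 := hm hu.enorm (hu.sub hf).enorm
  have h3 := hm (hu.sub hf).enorm hf.enorm
  refine le_trans ?_ (add_le_add_left
    (ENNReal.lintegral_Lp_add_le h1.aemeasurable h2.aemeasurable one_le_two) _)
  refine le_trans ?_ (ENNReal.lintegral_Lp_add_le (h1.add h2).aemeasurable h3.aemeasurable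
    one_le_two)
  refine ENNReal.rpow_le_rpow (lintegral_mono fun p => ?_) (by norm_num)
  refine ENNReal.rpow_le_rpow ?_ (by norm_num)
  simp only [A, Pi.add_apply]
  rw [← add_mul, ← add_mul]
  refine mul_le_mul' ?_ le_rfl
  have e1 : ‖f p.1‖ₑ ≤ ‖u p.1‖ₑ + ‖u p.1 - f p.1‖ₑ := by
    calc _ = ‖u p.1 - (u p.1 - f p.1)‖ₑ := by rw [sub_sub_cancel]
      _ ≤ _ := enorm_sub_le
  have e2 : ‖f p.2‖ₑ ≤ ‖u p.2‖ₑ + ‖u p.2 - f p.2‖ₑ := by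
    calc _ = ‖u p.2 - (u p.2 - f p.2)‖ₑ := by rw [sub_sub_cancel]
      _ ≤ _ := enorm_sub_le
  calc _ ≤ (‖u p.1‖ₑ + ‖u p.1 - f p.1‖ₑ) * ‖f p.2‖ₑ := by gcongr
    _ = ‖u p.1‖ₑ * ‖f p.2‖ₑ + ‖u p.1 - f p.1‖ₑ * ‖f p.2‖ₑ := add_mul _ _ _
    _ ≤ ‖u p.1‖ₑ * (‖u p.2‖ₑ + ‖u p.2 - f p.2‖ₑ) + ‖u p.1 - f p.1‖ₑ * ‖f p.2‖ₑ := by gcongr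
    _ = _ := by rw [mul_add]; rfl

/-! ### Approximating sequences and the Sobolev inequality -/

/-- The norm of `H^{1/2}`. -/
def sobolevNorm (u : L2) : ℝ≥0∞ := eLpNorm (weightedFourier u) 2 volume

lemma enorm_le_sobolevNorm (u : L2) : ‖u‖ₑ ≤ sobolevNorm u := by
  have h : ‖u‖ₑ = ‖(𝓕 u : L2)‖ₑ := by rw [← ofReal_norm, ← ofReal_norm, Lp.norm_fourier_eq]
  rw [h, Lp.enorm_def]
  refine eLpNorm_mono fun ξ => ?_
  rw [weightedFourier, norm_smul, Real.norm_of_nonneg (by positivity)]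
  refine le_mul_of_one_le_left (norm_nonneg _) ?_
  exact Real.one_le_rpow (by nlinarith [sq_nonneg ‖ξ‖]) (by norm_num)

lemma lintegral_sq_le_sobolevNorm (u : L2) : ∫⁻ x, ‖u x‖ₑ ^ 2 ≤ sobolevNorm u ^ 2 := by
  rw [lintegral_sq_eq_eLpNorm_sq, ← Lp.enorm_def]
  gcongr
  exact enorm_le_sobolevNorm u

lemma sobolevNorm_le_add (u v : L2) : sobolevNorm v ≤ sobolevNorm u + sobolevNorm (u - v) := by
  have h : weightedFourier v =ᵐ[volume] weightedFourier u - weightedFourier (u - v) := by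
    filter_upwards [weightedFourier_sub u v] with ξ hξ
    rw [Pi.sub_apply, hξ, Pi.sub_apply, sub_sub_cancel]
  rw [sobolevNorm, eLpNorm_congr_ae h]
  exact eLpNorm_sub_le (aestronglyMeasurable_weightedFourier _)
    (aestronglyMeasurable_weightedFourier _) (by simp)

/-- Approximation of an element of `H^{1/2}` by compactly supported smooth functions, both in norm
and almost everywhere. -/
lemma exists_seq_approx (u : L2) (hu : sobolevNormSq (1 / 2) u < ⊤) {δ : ℝ} (hδ : 0 < δ) :
    ∃ (f : ℕ → 𝓢(R3, ℂ)) (d : ℕ → ℝ), (∀ n, HasCompactSupport (f n)) ∧ (∀ n, 0 < d n) ∧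
      (∀ n, d n ≤ δ) ∧ Tendsto d atTop (𝓝 0) ∧
      (∀ n, sobolevNorm (u - (f n).toLp 2 volume) ≤ ENNReal.ofReal (d n)) ∧
      ∀ᵐ x, Tendsto (fun n => f n x) atTop (𝓝 (u x)) := by
  have hd0 : ∀ n : ℕ, 0 < δ * (1 / ((n : ℝ) + 1)) := fun n => by positivity
  have hdt : Tendsto (fun n : ℕ => δ * (1 / ((n : ℝ) + 1))) atTop (𝓝 0) := by
    simpa using tendsto_one_div_add_atTop_nhds_zero_nat.const_mul δ
  choose f hfc hf using fun n : ℕ => exists_compactSupport_approx u hu (hd0 n)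
  have hlim : Tendsto (fun n => (f n).toLp 2 (volume : Measure R3)) atTop (𝓝 u) := by
    rw [tendsto_iff_norm_sub_tendsto_zero]
    refine squeeze_zero (fun n => norm_nonneg _) (fun n => ?_) hdt
    have h1 := (enorm_le_sobolevNorm (u - (f n).toLp 2 volume)).trans (hf n)
    rw [← ofReal_norm, ENNReal.ofReal_le_ofReal_iff (hd0 n).le] at h1
    rwa [norm_sub_rev]
  obtain ⟨ns, hns, hae⟩ := (tendstoInMeasure_of_tendsto_Lp hlim).exists_seq_tendsto_ae
  refine ⟨fun n => f (ns n), fun n => δ * (1 / (((ns n : ℕ) : ℝ) + 1)), fun n => hfc _,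
    fun n => hd0 _, fun n => ?_, hdt.comp hns.tendsto_atTop, fun n => hf _, ?_⟩
  · refine mul_le_of_le_one_right hδ.le ?_
    rw [div_le_one (by positivity)]
    linarith [(Nat.cast_nonneg (ns n) : (0 : ℝ) ≤ (ns n : ℕ))]
  · have hall : ∀ᵐ x, ∀ n, (f (ns n)).toLp 2 (volume : Measure R3) x = f (ns n) x :=
      ae_all_iff.2 fun n => (f (ns n)).coeFn_toLp 2 volume
    filter_upwards [hae, hall] with x h1 h2
    simpa [h2] using h1

lemma powerIntegral_le_liminf {f : ℕ → 𝓢(R3, ℂ)} {u : R3 → ℂ}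
    (h : ∀ᵐ x, Tendsto (fun n => f n x) atTop (𝓝 (u x))) :
    powerIntegral u ≤ liminf (fun n => powerIntegral (f n)) atTop := by
  refine le_trans (le_of_eq ?_) (lintegral_liminf_le fun n => ?_)
  · refine lintegral_congr_ae ?_
    filter_upwards [h] with x hx
    have : Tendsto (fun n => ‖f n x‖ₑ ^ (8 / 3 : ℝ)) atTop (𝓝 (‖u x‖ₑ ^ (8 / 3 : ℝ))) :=
      (ENNReal.continuous_rpow_const.tendsto _).comp ((continuous_enorm.tendsto _).comp hx)
    exact this.liminf_eq.symm
  · have := (f n).continuous.measurable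
    fun_prop

/-- The Sobolev inequality `∫ |u|^{8/3} ≤ C ‖u‖_{H^{1/2}}^{8/3}`. -/
lemma exists_powerIntegral_le_sobolevNorm : ∃ C : ℝ, 0 < C ∧ ∀ (u : L2) (X : ℝ), 0 < X →
    sobolevNorm u ≤ ENNReal.ofReal X →
    powerIntegral u ≤ ENNReal.ofReal (C * X ^ (8 / 3 : ℝ)) := by
  obtain ⟨C, hC, h⟩ := exists_powerIntegral_le
  refine ⟨C * 4 ^ (4 / 3 : ℝ), by positivity, fun u X hX hu => ?_⟩
  have hH : sobolevNormSq (1 / 2) u < ⊤ := by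
    rw [sobolevNormSq_eq_eLpNorm_sq]
    exact ENNReal.pow_lt_top (hu.trans_lt ENNReal.ofReal_lt_top)
  obtain ⟨f, d, -, hd, hdX, -, hf, hae⟩ := exists_seq_approx u hH hX
  refine (powerIntegral_le_liminf hae).trans ?_
  have key : ∀ n, powerIntegral (f n) ≤ ENNReal.ofReal (C * 4 ^ (4 / 3 : ℝ) * X ^ (8 / 3 : ℝ)) := by
    intro n
    have h1 : sobolevNorm ((f n).toLp 2 volume) ≤ ENNReal.ofReal (2 * X) := by
      calc _ ≤ _ := sobolevNorm_le_add u _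
        _ ≤ ENNReal.ofReal X + ENNReal.ofReal X :=
          add_le_add hu ((hf n).trans (ENNReal.ofReal_le_ofReal (hdX n)))
        _ = _ := by rw [← ENNReal.ofReal_add hX.le hX.le, two_mul]
    have h2 : sobolevNormSq (1 / 2) ((f n).toLp 2 volume) ≤ ENNReal.ofReal (4 * X ^ 2) := by
      rw [sobolevNormSq_eq_eLpNorm_sq, show 4 * X ^ 2 = (2 * X) ^ 2 by ring,
        ENNReal.ofReal_pow (by positivity)]
      exact pow_le_pow_left' h1 2
    refine (h (f n) _ (by positivity) h2).trans (le_of_eq ?_)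
    congr 1
    rw [Real.mul_rpow (by norm_num) (by positivity), ← Real.rpow_natCast, ← Real.rpow_mul hX.le]
    norm_num
    ring
  calc _ ≤ liminf (fun _ : ℕ => ENNReal.ofReal (C * 4 ^ (4 / 3 : ℝ) * X ^ (8 / 3 : ℝ))) atTop :=
        liminf_le_liminf (Eventually.of_forall key)
    _ = _ := liminf_const _

/-! ### Passage to the limit in the energy inequality -/

/-- Both terms of `mixedCoulomb_le` have degree two in X and in Y. The bilinear form of the bound
makes the cross terms vanish when one factor is small. -/
lemma exists_sqrt_mixedCoulomb_le {C : ℝ} (hC : 0 < C) : ∃ K : ℝ, 0 < K ∧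
    ∀ (a b : R3 → ℝ≥0∞) (X Y : ℝ), Measurable a → Measurable b → 0 < X → 0 < Y →
      ∫⁻ x, a x ^ 2 ≤ ENNReal.ofReal (X ^ 2) →
      ∫⁻ x, a x ^ (8 / 3 : ℝ) ≤ ENNReal.ofReal (C * X ^ (8 / 3 : ℝ)) →
      ∫⁻ x, b x ^ 2 ≤ ENNReal.ofReal (Y ^ 2) →
      ∫⁻ x, b x ^ (8 / 3 : ℝ) ≤ ENNReal.ofReal (C * Y ^ (8 / 3 : ℝ)) →
      mixedCoulomb a b ^ (1 / 2 : ℝ) ≤ ENNReal.ofReal (K * X * Y) := by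
  set κ := (∫⁻ z, localKernel z ^ 2).toReal
  have hκ : ∫⁻ z, localKernel z ^ 2 = ENNReal.ofReal κ :=
    (ENNReal.ofReal_toReal lintegral_localKernel_sq_ne_top).symm
  have hκ0 : 0 ≤ κ := ENNReal.toReal_nonneg
  set L := 1 + C * (C ^ (1 / 2 : ℝ) * κ ^ (1 / 2 : ℝ)) with hL
  have hL0 : 0 < L := by positivity
  refine ⟨L ^ (1 / 2 : ℝ), by positivity, fun a b X Y ha hb hX hY h1 h2 h3 h4 => ?_⟩
  have key : mixedCoulomb a b ≤ ENNReal.ofReal (L * (X * Y) ^ 2) := by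
    refine (mixedCoulomb_le ha hb).trans ?_
    rw [hκ]
    calc _ ≤ ENNReal.ofReal (X ^ 2) * ENNReal.ofReal (Y ^ 2)
          + (ENNReal.ofReal (C * X ^ (8 / 3 : ℝ)) * ENNReal.ofReal (C * Y ^ (8 / 3 : ℝ))) ^ (1 / 2 : ℝ)
          * ((ENNReal.ofReal (C * X ^ (8 / 3 : ℝ)) * ENNReal.ofReal κ) ^ (1 / 2 : ℝ) *
            (ENNReal.ofReal (C * Y ^ (8 / 3 : ℝ)) * ENNReal.ofReal κ) ^ (1 / 2 : ℝ)) ^ (1 / 2 : ℝ) := by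
          refine add_le_add (mul_le_mul' h1 h3) (mul_le_mul' ?_ ?_)
          · exact ENNReal.rpow_le_rpow (mul_le_mul' h2 h4) (by norm_num)
          · refine ENNReal.rpow_le_rpow (mul_le_mul' ?_ ?_) (by norm_num)
            · exact ENNReal.rpow_le_rpow (mul_le_mul' h2 le_rfl) (by norm_num)
            · exact ENNReal.rpow_le_rpow (mul_le_mul' h4 le_rfl) (by norm_num)
      _ = _ := by
        have hsq : ∀ x : ℝ, 0 < x → x ^ (8 / 3 : ℝ) = (x ^ (2 / 3 : ℝ)) ^ 4 := by
          intro x hx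
          rw [← Real.rpow_natCast, ← Real.rpow_mul hx.le]; norm_num
        have hcube : ∀ x : ℝ, 0 < x → x = (x ^ (1 / 3 : ℝ)) ^ 3 := by
          intro x hx
          rw [← Real.rpow_natCast, ← Real.rpow_mul hx.le]; norm_num
        have h23 : ∀ x : ℝ, 0 < x → x ^ (2 / 3 : ℝ) = (x ^ (1 / 3 : ℝ)) ^ 2 := by
          intro x hx
          rw [← Real.rpow_natCast, ← Real.rpow_mul hx.le]; norm_num
        have hX' : 0 < X ^ (1 / 3 : ℝ) := by positivity
        have hY' : 0 < Y ^ (1 / 3 : ℝ) := by positivity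
        -- Passing to the cube roots x and y of X and Y makes all their exponents integers, so the
        -- square roots can be evaluated by `ring`.
        rw [hsq X hX, hsq Y hY, h23 X hX, h23 Y hY]
        have eX := hcube X hX
        have eY := hcube Y hY
        set x := X ^ (1 / 3 : ℝ)
        set y := Y ^ (1 / 3 : ℝ)
        rw [eX, eY]
        have hs : ∀ z : ℝ, 0 ≤ z → ENNReal.ofReal z ^ (1 / 2 : ℝ) = ENNReal.ofReal (Real.sqrt z) := by
          intro z hz
          rw [ENNReal.ofReal_rpow_of_nonneg hz (by norm_num), Real.sqrt_eq_rpow]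
        rw [← ENNReal.ofReal_mul (by positivity), ← ENNReal.ofReal_mul (by positivity),
          ← ENNReal.ofReal_mul (by positivity), ← ENNReal.ofReal_mul (by positivity),
          hs _ (by positivity), hs _ (by positivity), hs _ (by positivity),
          ← ENNReal.ofReal_mul (by positivity), hs _ (by positivity),
          ← ENNReal.ofReal_mul (by positivity), ← ENNReal.ofReal_add (by positivity) (by positivity)]
        congr 1
        have s1 : Real.sqrt (C * (x ^ 2) ^ 4 * (C * (y ^ 2) ^ 4)) = C * (x * y) ^ 4 := by
          rw [show C * (x ^ 2) ^ 4 * (C * (y ^ 2) ^ 4) = (C * (x * y) ^ 4) ^ 2 by ring,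
            Real.sqrt_sq (by positivity)]
        have s2 : ∀ w : ℝ, 0 < w → Real.sqrt (C * (w ^ 2) ^ 4 * κ) = Real.sqrt (C * κ) * w ^ 4 := by
          intro w hw
          rw [show C * (w ^ 2) ^ 4 * κ = (C * κ) * (w ^ 4) ^ 2 by ring,
            Real.sqrt_mul (by positivity), Real.sqrt_sq (by positivity)]
        have s3 : Real.sqrt (Real.sqrt (C * κ) * x ^ 4 * (Real.sqrt (C * κ) * y ^ 4))
            = Real.sqrt (C * κ) * (x * y) ^ 2 := by
          rw [show Real.sqrt (C * κ) * x ^ 4 * (Real.sqrt (C * κ) * y ^ 4)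
            = (Real.sqrt (C * κ) * (x * y) ^ 2) ^ 2 by ring, Real.sqrt_sq (by positivity)]
        rw [s1, s2 x hX', s2 y hY', s3, hL, ← Real.sqrt_eq_rpow, ← Real.sqrt_eq_rpow,
          Real.sqrt_mul hC.le]
        ring
  refine (ENNReal.rpow_le_rpow key (by norm_num)).trans (le_of_eq ?_)
  rw [ENNReal.ofReal_rpow_of_nonneg (by positivity) (by norm_num),
    Real.mul_rpow (by positivity) (by positivity), ← Real.sqrt_eq_rpow ((X * Y) ^ 2),
    Real.sqrt_sq (by positivity), mul_assoc]

/-- The energy inequality extends from compactly supported smooth functions to `H^{1/2}`. -/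
lemma energy_inequality_of_compactSupport {α β : ℝ} (hβ : 0 < β)
    (h : ∀ f : 𝓢(R3, ℂ), HasCompactSupport f → ENNReal.ofReal β * powerIntegral f
      ≤ ENNReal.ofReal (1 / 2) * kinetic f + ENNReal.ofReal α * coulomb f)
    (u : L2) (hu : sobolevNormSq (1 / 2) u < ⊤) :
    ENNReal.ofReal β * powerIntegral u
      ≤ ENNReal.ofReal (1 / 2) * sobolevNormSq (1 / 2) u + ENNReal.ofReal α * coulomb u := by
  obtain ⟨C, hC, hSob⟩ := exists_powerIntegral_le_sobolevNorm
  obtain ⟨K, hK, hmix⟩ := exists_sqrt_mixedCoulomb_le hC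
  obtain ⟨f, d, hfc, hd, hd1, hdt, hf, hae⟩ := exists_seq_approx u hu one_pos
  have hNtop : sobolevNorm u ≠ ⊤ := by
    rw [sobolevNormSq_eq_eLpNorm_sq] at hu
    exact ((ENNReal.pow_lt_top_iff.1 hu).resolve_right (by norm_num)).ne
  -- The added 1 makes X positive even when u = 0; as d n ≤ 1, the approximants have norm at most X
  -- + 1.
  set X := (sobolevNorm u).toReal + 1 with hX
  have hX0 : 0 < X := by positivity
  have hNX : sobolevNorm u ≤ ENNReal.ofReal X := by
    rw [← ENNReal.ofReal_toReal hNtop]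
    exact ENNReal.ofReal_le_ofReal (by linarith)
  have hmass : ∀ (v : L2) (Y : ℝ), 0 < Y → sobolevNorm v ≤ ENNReal.ofReal Y →
      ∫⁻ x, ‖v x‖ₑ ^ 2 ≤ ENNReal.ofReal (Y ^ 2) := by
    intro v Y hY hv
    rw [ENNReal.ofReal_pow hY.le]
    exact (lintegral_sq_le_sobolevNorm v).trans (pow_le_pow_left' hv 2)
  have hum : Measurable u := (Lp.stronglyMeasurable u).measurable
  have hNf : ∀ n, sobolevNorm ((f n).toLp 2 volume) ≤ sobolevNorm u + ENNReal.ofReal (d n) :=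
    fun n => (sobolevNorm_le_add u _).trans (add_le_add le_rfl (hf n))
  have hcoul : ∀ n, coulomb (f n) ≤ (coulomb u ^ (1 / 2 : ℝ) + ENNReal.ofReal (K * X * d n)
      + ENNReal.ofReal (K * d n * (X + 1))) ^ 2 := by
    intro n
    have hfm : Measurable (f n) := (f n).continuous.measurable
    set v : L2 := u - (f n).toLp 2 volume with hv
    have hva : (v : R3 → ℂ) =ᵐ[volume] fun x => u x - f n x := by
      filter_upwards [Lp.coeFn_sub u ((f n).toLp 2 volume), (f n).coeFn_toLp 2 volume] with x h1 h2
      rw [h1, Pi.sub_apply, h2]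
    have hfa := (f n).coeFn_toLp 2 (volume : Measure R3)
    have hNf' : sobolevNorm ((f n).toLp 2 volume) ≤ ENNReal.ofReal (X + 1) := by
      refine (hNf n).trans ?_
      rw [ENNReal.ofReal_add hX0.le one_pos.le]
      exact add_le_add hNX (ENNReal.ofReal_le_ofReal (hd1 n))
    have hv1 : ∫⁻ x, ‖u x - f n x‖ₑ ^ 2 ≤ ENNReal.ofReal (d n ^ 2) := by
      refine le_trans (le_of_eq (lintegral_congr_ae ?_)) (hmass v _ (hd n) (hf n))
      filter_upwards [hva] with x hx
      rw [hx]
    have hv2 : ∫⁻ x, ‖u x - f n x‖ₑ ^ (8 / 3 : ℝ) ≤ ENNReal.ofReal (C * d n ^ (8 / 3 : ℝ)) :=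
      (powerIntegral_congr_ae hva).symm.le.trans (hSob v _ (hd n) (hf n))
    have hf1 : ∫⁻ x, ‖f n x‖ₑ ^ 2 ≤ ENNReal.ofReal ((X + 1) ^ 2) := by
      refine le_trans (le_of_eq (lintegral_congr_ae ?_)) (hmass _ _ (by linarith) hNf')
      filter_upwards [hfa] with x hx
      rw [hx]
    have hf2 : ∫⁻ x, ‖f n x‖ₑ ^ (8 / 3 : ℝ) ≤ ENNReal.ofReal (C * (X + 1) ^ (8 / 3 : ℝ)) :=
      (powerIntegral_congr_ae hfa).symm.le.trans (hSob _ _ (by linarith) hNf')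
    have key : coulomb (f n) ^ (1 / 2 : ℝ) ≤ coulomb u ^ (1 / 2 : ℝ)
        + ENNReal.ofReal (K * X * d n) + ENNReal.ofReal (K * d n * (X + 1)) := by
      refine (sqrt_coulomb_le hfm hum).trans (add_le_add (add_le_add le_rfl ?_) ?_)
      · exact hmix _ _ X (d n) hum.enorm (hum.sub hfm).enorm hX0 (hd n) (hmass u X hX0 hNX)
          (hSob u X hX0 hNX) hv1 hv2
      · exact hmix _ _ (d n) (X + 1) (hum.sub hfm).enorm hfm.enorm (hd n) (by linarith) hv1 hv2
          hf1 hf2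
    have := pow_le_pow_left' key 2
    rwa [rpow_mul_rpow_sq _ (show (1 / 2 : ℝ) * 2 = 1 by norm_num), ENNReal.rpow_one] at this
  have hkin : ∀ n, kinetic (f n) ≤ (sobolevNorm u + ENNReal.ofReal (d n)) ^ 2 := by
    intro n
    refine le_trans ?_ (pow_le_pow_left' (hNf n) 2)
    rw [sobolevNorm, ← sobolevNormSq_eq_eLpNorm_sq, sobolevNormSq_toLp]
    refine lintegral_mono fun ξ => ?_
    gcongr
    rw [← Real.sqrt_eq_rpow]
    exact Real.le_sqrt_of_sq_le (by linarith)
  have hβ0 : ENNReal.ofReal β ≠ 0 := by simpa using hβ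
  let R : ℕ → ℝ≥0∞ := fun n =>
    ENNReal.ofReal (1 / 2) * (sobolevNorm u + ENNReal.ofReal (d n)) ^ 2
      + ENNReal.ofReal α * (coulomb u ^ (1 / 2 : ℝ) + ENNReal.ofReal (K * X * d n)
        + ENNReal.ofReal (K * d n * (X + 1))) ^ 2
  -- Isolating P on the left suits Fatou, which bounds P(u) by the lower limit; on the right only
  -- upper bounds converging to the values at u are needed.
  have hR : ∀ n, powerIntegral (f n) ≤ (ENNReal.ofReal β)⁻¹ * R n := by
    intro n
    rw [← ENNReal.mul_le_iff_le_inv hβ0 (by simp)]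
    refine (h (f n) (hfc n)).trans (add_le_add ?_ ?_)
    · exact mul_le_mul' le_rfl (hkin n)
    · exact mul_le_mul' le_rfl (hcoul n)
  have hRt : Tendsto R atTop (𝓝 (ENNReal.ofReal (1 / 2) * sobolevNormSq (1 / 2) u
      + ENNReal.ofReal α * coulomb u)) := by
    have t1 : Tendsto (fun n => ENNReal.ofReal (d n)) atTop (𝓝 0) := by
      simpa using ENNReal.tendsto_ofReal hdt
    have t2 : Tendsto (fun n => ENNReal.ofReal (K * X * d n)) atTop (𝓝 0) := by
      simpa using ENNReal.tendsto_ofReal (hdt.const_mul (K * X))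
    have t3 : Tendsto (fun n => ENNReal.ofReal (K * d n * (X + 1))) atTop (𝓝 0) := by
      simpa using ENNReal.tendsto_ofReal ((hdt.const_mul K).mul_const (X + 1))
    have e1 : sobolevNormSq (1 / 2) u = (sobolevNorm u + 0) ^ 2 := by
      rw [add_zero, sobolevNormSq_eq_eLpNorm_sq, sobolevNorm]
    have e2 : coulomb u = (coulomb u ^ (1 / 2 : ℝ) + 0 + 0) ^ 2 := by
      rw [add_zero, add_zero, rpow_mul_rpow_sq _ (show (1 / 2 : ℝ) * 2 = 1 by norm_num),
        ENNReal.rpow_one]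
    nth_rewrite 1 [e2]
    rw [e1]
    refine Tendsto.add ?_ ?_
    · refine ENNReal.Tendsto.const_mul ?_ (.inr (by simp))
      exact ((ENNReal.continuous_pow 2).tendsto _).comp (tendsto_const_nhds.add t1)
    · refine ENNReal.Tendsto.const_mul ?_ (.inr (by simp))
      exact ((ENNReal.continuous_pow 2).tendsto _).comp ((tendsto_const_nhds.add t2).add t3)
  rw [ENNReal.mul_le_iff_le_inv hβ0 (by simp)]
  calc _ ≤ _ := powerIntegral_le_liminf hae
    _ ≤ liminf (fun n => (ENNReal.ofReal β)⁻¹ * R n) atTop :=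
      liminf_le_liminf (Eventually.of_forall hR)
    _ = _ := (ENNReal.Tendsto.const_mul hRt (.inr (by simp [hβ]))).liminf_eq

/-- The density argument gives the inequality between the terms; the Sobolev embedding makes the
subtracted one finite, which excludes ∞ - ∞ in `EReal`. -/
lemma energy_nonneg {α β : ℝ} (hα : 0 < α) (hβ : 0 < β)
    (h : ENNReal.ofReal (Real.sqrt 2) * bestConstant
      ≤ ENNReal.ofReal ((27 * α / β ^ 3) ^ (1 / 8 : ℝ)))
    (u : L2) (hu : sobolevNormSq (1 / 2) u < ⊤) : 0 ≤ energy (8 / 3) α β u := by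
  have key := energy_inequality_of_compactSupport hβ
    (fun f hf => coulomb_interpolation_of_le hα hβ h (f.smooth ⊤) hf) u hu
  have hP : powerIntegral u ≠ ⊤ := by
    obtain ⟨C, -, hSob⟩ := exists_powerIntegral_le_sobolevNorm
    have hNtop : sobolevNorm u ≠ ⊤ := by
      rw [sobolevNormSq_eq_eLpNorm_sq] at hu
      exact ((ENNReal.pow_lt_top_iff.1 hu).resolve_right (by norm_num)).ne
    refine ne_top_of_le_ne_top ENNReal.ofReal_ne_top (hSob u ((sobolevNorm u).toReal + 1)
      (by positivity) ?_)
    nth_rewrite 1 [← ENNReal.ofReal_toReal hNtop]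
    exact ENNReal.ofReal_le_ofReal (by linarith)
  have hc : ∀ (x : ℝ) (y : ℝ≥0∞), 0 ≤ x →
      (x : EReal) * (y : EReal) = ((ENNReal.ofReal x * y : ℝ≥0∞) : EReal) := by
    intro x y hx
    rw [EReal.coe_ennreal_mul, EReal.coe_ennreal_ofReal, max_eq_left hx]
  rw [energy, hc _ _ (by norm_num), hc _ _ hα.le, hc _ _ hβ.le, ← EReal.coe_ennreal_add]
  have hfin : ENNReal.ofReal β * powerIntegral u ≠ ⊤ := ENNReal.mul_ne_top (by simp) hP
  refine (EReal.sub_nonneg (.inr ?_) (.inr ?_)).2 (EReal.coe_ennreal_le_coe_ennreal_iff.2 key)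
  · exact fun h => hfin (EReal.coe_ennreal_eq_top_iff.1 h)
  · exact EReal.coe_ennreal_ne_bot _

end SemiRelativistic

end

theorem theorem1p2 (α β : ℝ) (hα : 0 < α) (hβ : 0 < β) :
    (∃ ρ : ℝ, 0 < ρ ∧ SemiRelativistic.minEnergy (8 / 3) α β ρ = ⊥) ↔
      ENNReal.ofReal ((27 * α / β ^ 3) ^ (1 / 8 : ℝ))
        < ENNReal.ofReal (Real.sqrt 2) * SemiRelativistic.bestConstant := by
  refine ⟨fun ⟨ρ, _, hρ⟩ => ?_,
    SemiRelativistic.exists_minEnergy_eq_bot_of_lt_bestConstant hα hβ⟩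
  by_contra! hle
  have h0 : 0 ≤ SemiRelativistic.minEnergy (8 / 3) α β ρ :=
    le_iInf₂ fun u hu => SemiRelativistic.energy_nonneg hα hβ hle u hu.1
  rw [hρ] at h0
  simp at h0
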